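/- **Setting.** Let $\mathcal U$ be a set of statements and $\mathcal F\subseteq\mathbb R^{\mathcal U}$ a set of utility functions. The VC-dimension of the statement space $(\mathcal U,\mathcal F)$ is the largest $m\in\mathbb N$ for which there are $u_1,\dots,u_m\in\mathcal F$ and $\theta\in\mathbb R$ such that for every $I\subseteq\{1,\dots,m\}$ some $\alpha\in\mathcal U$ satisfies $u_i(\alpha)\ge\theta$ for $i\in I$ and $u_i(\alpha)<\theta$ for $i\notin I$. An instance consists of $n\ge 1$ agents $N$ with utility functions $u_i\in\mathcal F$, and a slate size $k\ge 1$. A slate is a multiset $W$ of $k$ statements. It satisfies balanced justified representation (BJR) if there is a map $\omega:N\to W$ that assigns $\lfloor n/k\rfloor$ or $\lceil n/k\rceil$ agents to each member of $W$ (counted with multiplicity) and for which there are no $S\subseteq N$, $\alpha\in\mathcal U$, $\theta\in\mathbb R$ with $|S|\ge n/k$ and $u_i(\alpha)\ge\theta>u_i(\omega(i))$ for all $i\in S$. A discriminative query $\mathrm{Disc}(i,\alpha)$ returns $u_i(\alpha)$. A generative query $t\text{-}\mathrm{Gen}(S,r)$, for $S\subseteq N$ with $|S|\le t$ and $0\le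 r\le|S|$, returns a statement $\alpha\in\mathcal U$ that maximizes the $r$-th largest (with multiplicity) of the utilities $u_i(\alpha)$, $i\in S$ (any statement if $r=0$), ties being broken arbitrarily, possibly depending on the past of the execution; the maximizers are assumed to exist. **Process.** Given a constant $C$ and $n,k,d,\delta$, let $m=\lfloor 16\,C\,k^4(d+\log(k/\delta))\rfloor$, let $n_x=n$ if $n\le 2m$ and $n_x=m$ otherwise, and let $\epsilon=\frac1{4k^2}$, $\bar r_x=n_x(\frac1k-\epsilon)$, $\bar r=n(\frac1k-2\epsilon)$. Start with $S=N$ and, for $j=1,\dots,k$: draw $n_x$ agents $X$ from $N$ uniformly without replacement; let $Y=X\cap S$; let $\alpha_j=\mathrm{Gen}(Y,\lceil\bar r_x\rceil)$ if $|Y|\ge\bar r_x$, and an arbitrary statement otherwise; let $r=\lceil\bar r\rceil$ if $j\le n-k\lfloor\bar r\rfloor$ and $r=\lfloor\bar r\rfloor$ otherwise; remove from $S$ the $r$ agents with largest utility for $\alpha_j$, determined by discriminative queries. Return the slate $\{\alpha_1,\dots,\alpha_k\}$. **Theorem.** There are absolute constants $C,K>0$ and a polynomial $P$ in two variables such that the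 following holds for every statement space $(\mathcal U,\mathcal F)$, every $d\in\mathbb N$ that is at least its VC-dimension, all $n,k\ge 1$, every $0<\delta\le 1$, and every instance with $n$ agents, slate size $k$ and utility functions in $\mathcal F$. With $t=n_x$, the process (run with the constant $C$) returns a slate of $k$ statements in time at most $P(n,k)$ in every execution, where elementary operations, random draws and queries are counted (with arithmetic on real numbers at unit cost, and a draw or a generative query charged in addition for the number of possibilities or agents it involves). It accesses statements and utilities only through discriminative queries, $t$-$\mathrm{Gen}$ queries, and requests for an arbitrary statement. Moreover $$t\le K\,k^4\Bigl(d+\log\frac k\delta\Bigr),$$ a bound independent of $n$. With probability at least $1-\delta$, the returned slate satisfies BJR. -/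

import Mathlib

universe u v w

namespace GenSocialChoice

noncomputable section

/-! ### Statement spaces, generative queries, and balanced justified representation -/

/-- `m` utility functions from `F` are shattered at one common threshold `θ`: every subset of them
is exactly the set of those that give some statement utility at least `θ`. -/
def Shatters {U : Type u} (F : Set (U → ℝ)) (m : ℕ) : Prop :=
  ∃ (f : Fin m → U → ℝ) (θ : ℝ), (∀ i, f i ∈ F) ∧
    ∀ I : Set (Fin m), ∃ a : U, (∀ i ∈ I, θ ≤ f i a) ∧ (∀ i ∉ I, f i a < θ)

/-- The VC-dimension of the statement space `(U, F)`; it is `⊤` if there is no largest `m`. -/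
def vcDim {U : Type u} (F : Set (U → ℝ)) : ℕ∞ :=
  ⨆ (m : ℕ) (_ : Shatters F m), (m : ℕ∞)

/-- The `r`-th largest element of a finite family of reals (counted with multiplicity),
with value `∞` for `r = 0`. Only `r ≤ X.card` is ever relevant. -/
def rthLargest (r : ℕ) (X : Multiset ℝ) : EReal :=
  match r with
  | 0 => ⊤
  | s + 1 => (((X.sort (· ≥ ·))[s]?).map fun x : ℝ => (x : EReal)).getD ⊥

/-- `a` is a correct answer to the generative query for the agents `S` and rank `r`. -/
def IsGenAnswer {n : ℕ} {U : Type u} (util : Fin n → U → ℝ) (S : Finset (Fin n)) (r : ℕ)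
    (a : U) : Prop :=
  ∀ b : U, rthLargest r (S.val.map fun i => util i b) ≤ rthLargest r (S.val.map fun i => util i a)

/-- Balanced justified representation of the slate `W`, a multiset of `k = W.length` statements
given by an enumeration. Agents are matched to places of the enumeration, so that copies of the
same statement count as different members of the slate. -/
def IsBJR {n : ℕ} {U : Type u} (util : Fin n → U → ℝ) (W : List U) : Prop :=
  ∃ ω : Fin n → Fin W.length,
    (∀ p, (Finset.univ.filter fun i => ω i = p).card = ⌊(n : ℝ) / W.length⌋₊ ∨
      (Finset.univ.filter fun i => ω i = p).card = ⌈(n : ℝ) / W.length⌉₊) ∧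
    ¬ ∃ (S : Finset (Fin n)) (a : U) (θ : ℝ), (n : ℝ) / W.length ≤ S.card ∧
      (∀ i ∈ S, θ ≤ util i a) ∧ (∀ i ∈ S, util i (W.get (ω i)) < θ)

/-! ### Democratic processes: randomized algorithms with query access

A democratic process for the agents `Fin n` is a tree of elementary operations. It cannot inspect
the universe of statements or the utilities other than through queries. -/

/-- `tick` is an elementary operation on data already at hand (an arithmetic operation, rounding,
logarithm or comparison of numbers, a comparison of agents, or one list operation at the head of a
list); `draw m` draws uniformly from `m + 1` possibilities; `disc i a` is a discriminative query;
`gen S r` is a generative query; `pick` obtains an arbitrary statement. -/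
inductive Proc (n : ℕ) (U : Type u) (β : Type v) : Type (max u v)
  | ret (b : β) : Proc n U β
  | tick (p : Proc n U β) : Proc n U β
  | draw (m : ℕ) (p : Fin (m + 1) → Proc n U β) : Proc n U β
  | disc (i : Fin n) (a : U) (p : ℝ → Proc n U β) : Proc n U β
  | gen (S : Finset (Fin n)) (r : ℕ) (p : U → Proc n U β) : Proc n U β
  | pick (p : U → Proc n U β) : Proc n U β

/-- Sequential composition. -/
def Proc.bind {n : ℕ} {U : Type u} {β : Type v} {γ : Type w} :
    Proc n U β → (β → Proc n U γ) → Proc n U γ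
  | .ret b, g => g b
  | .tick p, g => .tick (p.bind g)
  | .draw m p, g => .draw m fun x => (p x).bind g
  | .disc i a p, g => .disc i a fun x => (p x).bind g
  | .gen S r p, g => .gen S r fun x => (p x).bind g
  | .pick p, g => .pick fun x => (p x).bind g

/-- Perform `m` elementary operations and continue with `p`. -/
def Proc.ticks {n : ℕ} {U : Type u} {β : Type v} (m : ℕ) (p : Proc n U β) : Proc n U β :=
  Nat.rec p (fun _ q => .tick q) m

/-- The operations an execution performs; `draw m x` records the outcome `x` of the draw. -/
inductive Event (n : ℕ) (U : Type u) : Type u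
  | tick : Event n U
  | draw (m x : ℕ) : Event n U
  | disc (i : Fin n) (a : U) : Event n U
  | gen (S : Finset (Fin n)) (r : ℕ) : Event n U
  | pick : Event n U

/-- Running time of one operation. A generative query is charged for writing down the queried
agents, a draw for reading the possibilities it is drawn from. -/
def Event.cost {n : ℕ} {U : Type u} : Event n U → ℕ
  | .tick => 1
  | .draw m _ => m + 1
  | .disc _ _ => 1
  | .gen S _ => S.card + 1
  | .pick => 1

/-- Running time of an execution. -/
def runningTime {n : ℕ} {U : Type u} (h : List (Event n U)) : ℕ :=
  (h.map Event.cost).sum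

/-- What a process interacts with: the utilities of the agents, and the answers to its requests for
statements. Among equally good statements the choice is arbitrary; it may depend on everything that
has happened so far in the execution (the list of past events, latest first). -/
structure Env (n : ℕ) (U : Type u) where
  util : Fin n → U → ℝ
  gen : List (Event n U) → Finset (Fin n) → ℕ → U
  pick : List (Event n U) → U

/-- All generative queries to at most `t` agents are answered correctly. -/
def Env.AnswersGen {n : ℕ} {U : Type u} (E : Env n U) (t : ℕ) : Prop :=
  ∀ (h : List (Event n U)) (S : Finset (Fin n)) (r : ℕ), S.card ≤ t → r ≤ S.card →
    IsGenAnswer E.util S r (E.gen h S r)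

/-- The joint distribution of the output and of the list of events (latest first). -/
def run {n : ℕ} {U : Type u} {β : Type v} (E : Env n U) :
    Proc n U β → List (Event n U) → PMF (β × List (Event n U))
  | .ret b, h => PMF.pure (b, h)
  | .tick p, h => run E p (.tick :: h)
  | .draw m p, h => (PMF.uniformOfFintype (Fin (m + 1))).bind fun x =>
      run E (p x) (.draw m x :: h)
  | .disc i a p, h => run E (p (E.util i a)) (.disc i a :: h)
  | .gen S r p, h => run E (p (E.gen h S r)) (.gen S r :: h)
  | .pick p, h => run E (p (E.pick h)) (.pick :: h)

/-! ### Subroutines -/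

section Subroutines

variable {n : ℕ} {U : Type u}

/-- Remove the entry at position `x` from the list `a :: L`; return it and the remaining list. -/
def extract : Fin n → List (Fin n) → ℕ → Proc n U (Fin n × List (Fin n))
  | a, L, 0 => .tick (.ret (a, L))
  | a, [], _ + 1 => .tick (.ret (a, []))
  | a, b :: L, x + 1 => .tick <| (extract b L x).bind fun q => .tick (.ret (q.1, a :: q.2))

/-- Draw the given number of agents from a list, uniformly without replacement. -/
def sample : ℕ → List (Fin n) → Proc n U (List (Fin n))
  | 0, _ => .tick (.ret [])
  | _ + 1, [] => .tick (.ret [])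
  | m + 1, a :: L => .draw L.length fun x =>
      (extract a L x).bind fun q => (sample m q.2).bind fun X => .tick (.ret (q.1 :: X))

/-- Membership test. -/
def isMember (x : Fin n) : List (Fin n) → Proc n U Bool
  | [] => .tick (.ret false)
  | a :: L => .tick (if x = a then .ret true else isMember x L)

/-- Intersection of two lists of agents. -/
def intersection : List (Fin n) → List (Fin n) → Proc n U (List (Fin n))
  | [], _ => .tick (.ret [])
  | a :: X, S => (isMember a S).bind fun b => (intersection X S).bind fun Y =>
      .tick (.ret (if b then a :: Y else Y))

/-- Length of a list of agents. -/
def size : List (Fin n) → Proc n U ℕ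
  | [] => .tick (.ret 0)
  | _ :: L => (size L).bind fun m => .tick (.ret (m + 1))

/-- Ask every agent of a list for her utility for the statement `a`. -/
def askUtilities (a : U) : List (Fin n) → Proc n U (List (Fin n × ℝ))
  | [] => .tick (.ret [])
  | i :: S => .disc i a fun x => (askUtilities a S).bind fun L => .tick (.ret ((i, x) :: L))

open Classical in
/-- Insertion into a list that is sorted by decreasing utility. -/
def insertDesc (p : Fin n × ℝ) : List (Fin n × ℝ) → Proc n U (List (Fin n × ℝ))
  | [] => .tick (.ret [p])
  | q :: L => .tick (if q.2 ≤ p.2 then .ret (p :: q :: L)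
      else (insertDesc p L).bind fun M => .tick (.ret (q :: M)))

/-- Insertion sort by decreasing utility. -/
def sortDesc : List (Fin n × ℝ) → Proc n U (List (Fin n × ℝ))
  | [] => .tick (.ret [])
  | p :: L => (sortDesc L).bind fun M => insertDesc p M

/-- Forget the utilities. -/
def agentsOf : List (Fin n × ℝ) → Proc n U (List (Fin n))
  | [] => .tick (.ret [])
  | p :: L => (agentsOf L).bind fun S => .tick (.ret (p.1 :: S))

/-- Delete the first `r` entries of a list and forget the utilities. -/
def dropFirst : ℕ → List (Fin n × ℝ) → Proc n U (List (Fin n))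
  | 0, L => agentsOf L
  | _ + 1, [] => .tick (.ret [])
  | r + 1, _ :: L => .tick (dropFirst r L)

/-- From the agents `S`, remove the `r` agents with largest utility for the statement `a`. -/
def removeTop (a : U) (r : ℕ) (S : List (Fin n)) : Proc n U (List (Fin n)) :=
  (askUtilities a S).bind fun L => (sortDesc L).bind fun M => dropFirst r M

end Subroutines

/-! ### The sampling-based democratic process -/

/-- The sample size `n_x` for the constant `C`: the integer part of `16 C k⁴ (d + log (k / δ))`,
replaced by `n` if `n` is at most twice that number. -/
def sampleSize (C : ℝ) (n k d : ℕ) (δ : ℝ) : ℕ :=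
  let m := ⌊16 * C * (k : ℝ) ^ 4 * (d + Real.log (k / δ))⌋₊
  if n ≤ 2 * m then n else m

/-- The accuracy `ε`. -/
def eps (k : ℕ) : ℝ := 1 / (4 * (k : ℝ) ^ 2)

/-- The number `r̄_x` of sampled agents that a generated statement has to serve. -/
def rBarX (nx k : ℕ) : ℝ := nx * (1 / k - eps k)

/-- The number `r̄` of agents removed per round, before rounding. -/
def rBar (n k : ℕ) : ℝ := n * (1 / k - 2 * eps k)

/-- The number of agents removed in round `j`. -/
def removedInRound (n k j : ℕ) : ℕ :=
  if (j : ℤ) ≤ (n : ℤ) - k * ⌊rBar n k⌋ then ⌈rBar n k⌉₊ else ⌊rBar n k⌋₊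

open Classical in
/-- The statement that is added to the slate, given the intersection `Y` of the sample with the
remaining agents, and its size `y`. -/
def nextStatement {n : ℕ} {U : Type u} (nx k : ℕ) (Y : List (Fin n)) (y : ℕ) : Proc n U U :=
  if rBarX nx k ≤ (y : ℝ) then .gen Y.toFinset ⌈rBarX nx k⌉₊ .ret else .pick .ret

/-- `m` rounds of the process, starting with round `j` and the remaining agents `S`. The constant
number of ticks in a round covers the fixed number of arithmetic operations needed to evaluate
`rBarX`, `rBar`, `removedInRound` and to compare and count. -/
def rounds {n : ℕ} {U : Type u} (nx k : ℕ) : ℕ → ℕ → List (Fin n) → Proc n U (List U)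
  | 0, _, _ => .tick (.ret [])
  | m + 1, j, S =>
      (sample nx (List.finRange n)).bind fun X =>
      (intersection X S).bind fun Y =>
      (size Y).bind fun y =>
      (nextStatement nx k Y y).bind fun a =>
      .ticks 40 <|
      (removeTop a (removedInRound n k j) S).bind fun S' =>
      (rounds nx k m (j + 1) S').bind fun W =>
      .tick (.ret (a :: W))

/-- The sampling-based democratic process for slate size `k`, VC-dimension `d` and error
probability `δ`. The constant number of ticks covers the computation of the sample size. -/
def samplingProc (C : ℝ) (n : ℕ) (U : Type u) (k d : ℕ) (δ : ℝ) : Proc n U (List U) :=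
  .ticks 40 <| rounds (sampleSize C n k d δ) k k 1 (List.finRange n)

end

end GenSocialChoice

namespace GenSocialChoice

/-! ### Reasoning about executions -/

section Executions

variable {n : ℕ} {U : Type u} {β : Type v} {γ : Type w} {E : Env n U} {t : ℕ}

/-! Call a round good if its statement is nearly unbeatable: whenever some statement gives utility
at least `θ` to `n / k` of the remaining agents, the chosen one does so for at least `rBar` of them
(`RoundGood`). Suppose that all rounds are good, and represent every removed agent by the statement
of her round. Fewer than `n / k` agents survive all rounds (`remaining_lt`), so a coalition of size
at least `n / k` has a first round that removes one of its members. Up to then the whole coalition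
is present, so at least `⌈rBar⌉` agents get `θ` from the chosen statement. At most that many
favourites are removed, hence each of them gets `θ`, and the removed member has no complaint
(`RoundsOK.exists_assignment`). The survivors fill the groups up to balanced sizes
(`exists_completion`), and the slate satisfies BJR (`RoundsOK.isBJR`).

It remains to make each round fail with probability at most `δ / k`. A statement that is optimal on
the sample is good if the sample is accurate: it contains at least `rBarX` members of one large set,
and fewer than `rBarX` of every set that has fewer than `rBar` members and is served by one
statement at level `θ` (`rBar_le_of_accurate`). For fixed `θ` these sets form a family of
VC-dimension at most `d`, so uniform convergence applies (`psat_accurate`). It is proved by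
symmetrization with a second, disjoint sample: exchange partners at random and apply Sauer–Shelah to
the `2m` sampled points. Since the sets have density about `1 / k`, a multiplicative moment bound
gives an exponent of order `m / k ^ 3` instead of the additive `m / k ^ 4`; the factor `k` thus
saved pays for the logarithm of `k` from Sauer–Shelah.

The threshold ranges over infinitely many reals, and no joint VC bound is available. But only
finitely many pairs of a family and a large set can arise, and one of them recurs above every
relevant threshold (`exists_cofinal_colour`). Accuracy for that single pair suffices, because
utility at least `θ' ≥ θ` is utility at least `θ`. -/

theorem run_bind (E : Env n U) (p : Proc n U β) (g : β → Proc n U γ) (h : List (Event n U)) :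
    run E (p.bind g) h = (run E p h).bind fun o => run E (g o.1) o.2 := by
  induction p generalizing h with
  | ret b => simp [Proc.bind, run]
  | tick p ih => simp [Proc.bind, run, ih]
  | draw m p ih => simp [Proc.bind, run, ih, PMF.bind_bind]
  | disc i a p ih => simp [Proc.bind, run, ih]
  | gen S r p ih => simp [Proc.bind, run, ih]
  | pick p ih => simp [Proc.bind, run, ih]

/-- Every execution of `p` has an output satisfying `Q`, takes time at most `c`, and makes only
valid generative queries to at most `t` agents. -/
def Sat (E : Env n U) (t : ℕ) (p : Proc n U β) (c : ℕ) (Q : β → Prop) : Prop :=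
  ∀ h, ∀ o ∈ (run E p h).support, Q o.1 ∧ ∃ l, o.2 = l ++ h ∧ runningTime l ≤ c ∧
    ∀ S r, Event.gen S r ∈ l → S.card ≤ t ∧ r ≤ S.card

/-- From any history, the output of `p` violates `Q` with probability at most `η`. -/
def PSat (E : Env n U) (p : Proc n U β) (η : ENNReal) (Q : β → Prop) : Prop :=
  ∀ h, (run E p h).toOuterMeasure {o | ¬ Q o.1} ≤ η

theorem Sat.mono {p : Proc n U β} {c c' : ℕ} {Q Q' : β → Prop} (hp : Sat E t p c Q)
    (hc : c ≤ c') (hQ : ∀ b, Q b → Q' b) : Sat E t p c' Q' := fun h o ho => by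
  obtain ⟨h1, l, h2, h3, h4⟩ := hp h o ho
  exact ⟨hQ _ h1, l, h2, h3.trans hc, h4⟩

theorem Sat.ret {b : β} {c : ℕ} {Q : β → Prop} (hb : Q b) : Sat E t (.ret b) c Q := by
  intro h o ho
  obtain rfl : o = (b, h) := by simpa [run] using ho
  exact ⟨hb, [], by simp, by simp [runningTime], by simp⟩

theorem Sat.step {p : Proc n U β} {c : ℕ} {Q : β → Prop} (hp : Sat E t p c Q) (e : Event n U)
    (h : List (Event n U)) (he : ∀ S r, Event.gen S r = e → S.card ≤ t ∧ r ≤ S.card) :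
    ∀ o ∈ (run E p (e :: h)).support, Q o.1 ∧ ∃ l, o.2 = l ++ h ∧ runningTime l ≤ c + e.cost ∧
    ∀ S r, Event.gen S r ∈ l → S.card ≤ t ∧ r ≤ S.card := by
  intro o ho
  obtain ⟨h1, l, h2, h3, h4⟩ := hp _ o ho
  refine ⟨h1, l ++ [e], by simp [h2], ?_, ?_⟩
  · simp only [runningTime, List.map_append, List.sum_append] at h3 ⊢
    simpa using h3
  · intro S r hS
    rcases List.mem_append.1 hS with hS | hS
    · exact h4 S r hS
    · exact he S r (by simpa using hS)

theorem Sat.tick {p : Proc n U β} {c : ℕ} {Q : β → Prop} (hp : Sat E t p c Q) :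
    Sat E t (.tick p) (c + 1) Q := fun h =>
  hp.step .tick h (by simp)

theorem Sat.draw {m c : ℕ} {p : Fin (m + 1) → Proc n U β} {Q : β → Prop}
    (hp : ∀ x, Sat E t (p x) c Q) : Sat E t (.draw m p) (c + (m + 1)) Q := fun h o ho => by
  simp only [run, PMF.mem_support_bind_iff] at ho
  obtain ⟨x, -, hx⟩ := ho
  exact (hp x).step (.draw m x) h (by simp) o hx

theorem Sat.disc {i : Fin n} {a : U} {c : ℕ} {p : ℝ → Proc n U β} {Q : β → Prop}
    (hp : Sat E t (p (E.util i a)) c Q) : Sat E t (.disc i a p) (c + 1) Q := fun h =>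
  hp.step (.disc i a) h (by simp)

theorem Sat.gen {S : Finset (Fin n)} {r c : ℕ} {p : U → Proc n U β} {Q : β → Prop}
    (hE : E.AnswersGen t) (hS : S.card ≤ t) (hr : r ≤ S.card)
    (hp : ∀ a, IsGenAnswer E.util S r a → Sat E t (p a) c Q) :
    Sat E t (.gen S r p) (c + (S.card + 1)) Q := fun h =>
  (hp _ (hE h S r hS hr)).step (.gen S r) h (by rintro S r ⟨⟩; exact ⟨hS, hr⟩)

theorem Sat.pick {c : ℕ} {p : U → Proc n U β} {Q : β → Prop}
    (hp : ∀ a, Sat E t (p a) c Q) : Sat E t (.pick p) (c + 1) Q := fun h =>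
  (hp _).step .pick h (by simp)

theorem Sat.bind {p : Proc n U β} {g : β → Proc n U γ} {c c' : ℕ} {Q : β → Prop} {R : γ → Prop}
    (hp : Sat E t p c Q) (hg : ∀ b, Q b → Sat E t (g b) c' R) :
    Sat E t (p.bind g) (c + c') R := fun h o ho => by
  rw [run_bind, PMF.mem_support_bind_iff] at ho
  obtain ⟨o', ho', ho⟩ := ho
  obtain ⟨h1, l, h2, h3, h4⟩ := hp h o' ho'
  obtain ⟨k1, l', k2, k3, k4⟩ := hg _ h1 _ o ho
  refine ⟨k1, l' ++ l, by simp [k2, h2], ?_, fun S r hS => ?_⟩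
  · simp only [runningTime, List.map_append, List.sum_append] at h3 k3 ⊢
    omega
  · exact (List.mem_append.1 hS).elim (k4 S r) (h4 S r)

theorem Sat.ticks {p : Proc n U β} {c : ℕ} {Q : β → Prop} (hp : Sat E t p c Q) (m : ℕ) :
    Sat E t (.ticks m p) (c + m) Q := by
  induction m with
  | zero => exact hp
  | succ m ih => exact ih.tick

/-- A guarantee for every execution holds on the whole support, so conjoining it costs no
probability. -/
theorem Sat.and_left {p : Proc n U β} {c : ℕ} {Q : β → Prop} (hp : Sat E t p c Q)
    {η : ENNReal} {Q' : β → Prop} (hp' : PSat E p η Q') : PSat E p η fun b => Q b ∧ Q' b :=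
  fun h => by
    refine (PMF.toOuterMeasure_mono _ ?_).trans (hp' h)
    rintro o ⟨ho, ho'⟩ h'
    exact ho ⟨(hp h o ho').1, h'⟩

theorem PSat.mono {p : Proc n U β} {η η' : ENNReal} {Q Q' : β → Prop} (hp : PSat E p η Q)
    (hη : η ≤ η') (hQ : ∀ b, Q b → Q' b) : PSat E p η' Q' := fun h =>
  ((run E p h).toOuterMeasure.mono (show {o | ¬ Q' o.1} ⊆ {o | ¬ Q o.1} from
    fun _ ho ho' => ho (hQ _ ho'))).trans ((hp h).trans hη)

theorem PSat.zero_of_sat {p : Proc n U β} {c : ℕ} {Q : β → Prop} (hp : Sat E t p c Q) :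
    PSat E p 0 Q := fun h => by
  rw [nonpos_iff_eq_zero, PMF.toOuterMeasure_apply_eq_zero_iff, Set.disjoint_left]
  exact fun o ho ho' => ho' (hp h o ho).1

theorem PSat.tick {p : Proc n U β} {η : ENNReal} {Q : β → Prop} (hp : PSat E p η Q) :
    PSat E (.tick p) η Q := fun _ => hp _

theorem PSat.ticks {p : Proc n U β} {η : ENNReal} {Q : β → Prop} (hp : PSat E p η Q) (m : ℕ) :
    PSat E (.ticks m p) η Q := by
  induction m with
  | zero => exact hp
  | succ m ih => exact ih.tick

/-- Union bound: either the first part misses `Q`, or the continuation fails from an output that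
satisfies `Q`. -/
theorem PSat.bind {p : Proc n U β} {g : β → Proc n U γ} {η η' : ENNReal} {Q : β → Prop}
    {R : γ → Prop} (hp : PSat E p η Q) (hg : ∀ b, Q b → PSat E (g b) η' R) :
    PSat E (p.bind g) (η + η') R := fun h => by
  rw [run_bind, PMF.toOuterMeasure_bind_apply]
  calc _ ≤ ∑' o, ({o | ¬ Q o.1}.indicator (run E p h) o + run E p h o * η') := by
        refine ENNReal.tsum_le_tsum fun o => ?_
        by_cases ho : Q o.1
        · exact le_add_left (mul_le_mul_right (hg _ ho _) _)
        · refine le_add_right ?_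
          rw [Set.indicator_of_mem (by exact ho)]
          exact mul_le_of_le_one_right' (((run E (g o.1) o.2).toOuterMeasure.mono
            (Set.subset_univ _)).trans_eq <| (PMF.toOuterMeasure_apply_eq_one_iff _ _).2
              (Set.subset_univ _))
    _ ≤ η + η' := by
        rw [ENNReal.tsum_add, ENNReal.tsum_mul_right, PMF.tsum_coe, one_mul,
          ← PMF.toOuterMeasure_apply]
        gcongr
        exact hp h

theorem Sat.bind_psat {p : Proc n U β} {g : β → Proc n U γ} {c : ℕ} {η : ENNReal} {Q : β → Prop}
    {R : γ → Prop} (hp : Sat E t p c Q) (hg : ∀ b, Q b → PSat E (g b) η R) :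
    PSat E (p.bind g) η R := by
  simpa using (PSat.zero_of_sat hp).bind hg

theorem PSat.draw {m : ℕ} {p : Fin (m + 1) → Proc n U β} {η : Fin (m + 1) → ENNReal}
    {Q : β → Prop} (hp : ∀ x, PSat E (p x) (η x) Q) :
    PSat E (.draw m p) ((m + 1 : ENNReal)⁻¹ * ∑ x, η x) Q := fun h => by
  simp only [run, PMF.toOuterMeasure_bind_apply, PMF.uniformOfFintype_apply, tsum_fintype,
    Finset.mul_sum, Fintype.card_fin, Nat.cast_add, Nat.cast_one]
  exact Finset.sum_le_sum fun x _ => mul_le_mul_right (hp x _) _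

end Executions

/-! ### Subroutines -/

section Subroutines

variable {n : ℕ} {U : Type u} {E : Env n U} {t : ℕ}

theorem sat_extract (a : Fin n) (L : List (Fin n)) (x : ℕ) (hx : x ≤ L.length) :
    Sat E t (extract a L x) (2 * L.length + 1) fun q =>
      (a :: L)[x]? = some q.1 ∧ q.2 = (a :: L).eraseIdx x := by
  induction L generalizing a x with
  | nil =>
    obtain rfl : x = 0 := by simpa using hx
    exact (Sat.ret (c := 0) (by simp)).tick
  | cons b L ih =>
    cases x with
    | zero => exact ((Sat.ret (c := 0) (by simp)).tick).mono (by omega) fun _ => id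
    | succ x =>
      refine (((ih b x (by simpa using hx)).bind (c' := 1) (R := fun q =>
        (a :: b :: L)[x + 1]? = some q.1 ∧ q.2 = (a :: b :: L).eraseIdx (x + 1))
          fun q hq => (Sat.ret (c := 0) ?_).tick).tick).mono (by simp; omega) fun _ => id
      simpa using hq

theorem sat_sample (m : ℕ) (L : List (Fin n)) (hm : m ≤ L.length) (N : ℕ) (hN : L.length ≤ N) :
    Sat E t (sample m L) (m * (3 * N + 2) + 1) fun X => X.length = m ∧ X.Subperm L := by
  induction m generalizing L with
  | zero => simpa [sample] using (Sat.ret (c := 0) (by simp)).tick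
  | succ m ih =>
    cases L with
    | nil => simp at hm
    | cons a L =>
      simp only [List.length_cons] at hm hN
      have key : ∀ x : Fin (L.length + 1), Sat E t ((extract (U := U) a L x).bind fun q =>
          (sample m q.2).bind fun X => .tick (.ret (q.1 :: X)))
          ((2 * L.length + 1) + ((m * (3 * N + 2) + 1) + 1))
          fun X => X.length = m + 1 ∧ X.Subperm (a :: L) := fun x => by
        refine (sat_extract a L x (by omega)).bind fun q hq => ?_
        obtain ⟨hx, hq1⟩ := List.getElem?_eq_some_iff.1 hq.1
        have hlen : q.2.length = L.length := by
          rw [hq.2, List.length_eraseIdx_of_lt hx]; simp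
        refine (ih q.2 (by omega) (by omega)).bind fun X hX => (Sat.ret (c := 0) ?_).tick
        refine ⟨by simp [hX.1], ?_⟩
        have := List.getElem_cons_eraseIdx_perm hx
        rw [← hq.2, hq1] at this
        exact (List.subperm_cons _).2 hX.2 |>.trans this.subperm
      refine (Sat.draw key).mono ?_ fun _ => id
      nlinarith

theorem sat_isMember (x : Fin n) (L : List (Fin n)) :
    Sat E t (isMember x L) (L.length + 1) fun b => b = decide (x ∈ L) := by
  induction L with
  | nil => exact (Sat.ret (c := 0) (by simp)).tick
  | cons a L ih =>
    refine Sat.tick ?_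
    split_ifs with h
    · exact Sat.ret (by simp [h])
    · exact ih.mono (by simp) (by simp [h])

theorem sat_intersection (X S : List (Fin n)) :
    Sat E t (intersection X S) (X.length * (S.length + 2) + 1) fun Y =>
      Y = X.filter fun i => decide (i ∈ S) := by
  induction X with
  | nil => simpa [intersection] using (Sat.ret (c := 0) (by simp)).tick
  | cons a X ih =>
    refine ((sat_isMember a S).bind fun b hb => ih.bind (c' := 1) fun Y hY =>
      (Sat.ret (c := 0) ?_).tick).mono ?_ fun _ => id
    · subst hb hY
      by_cases h : a ∈ S <;> simp [h]
    · simp only [List.length_cons]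
      nlinarith

theorem sat_size (L : List (Fin n)) : Sat E t (size L) (L.length + 1) fun m => m = L.length := by
  induction L with
  | nil => exact (Sat.ret (c := 0) (by simp)).tick
  | cons a L ih =>
    exact (ih.bind (c' := 1) fun m hm => (Sat.ret (c := 0) (by simp [hm])).tick)

theorem sat_askUtilities (a : U) (S : List (Fin n)) :
    Sat E t (askUtilities a S) (2 * S.length + 1) fun L => L = S.map fun i => (i, E.util i a) := by
  induction S with
  | nil => exact (Sat.ret (c := 0) (by simp)).tick
  | cons i S ih =>
    exact (Sat.disc (ih.bind (c' := 1) fun L hL => (Sat.ret (c := 0) (by simp [hL])).tick)).mono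
      (by simp; omega) fun _ => id

theorem sat_insertDesc (p : Fin n × ℝ) (L : List (Fin n × ℝ))
    (hL : L.Pairwise fun q q' => q'.2 ≤ q.2) :
    Sat E t (insertDesc p L) (2 * L.length + 1) fun M =>
      M.Perm (p :: L) ∧ M.Pairwise fun q q' => q'.2 ≤ q.2 := by
  induction L with
  | nil => exact (Sat.ret (c := 0) (by simp)).tick
  | cons q L ih =>
    rw [List.pairwise_cons] at hL
    rw [insertDesc]
    split_ifs with h
    · refine (Sat.ret (c := 0) ⟨.refl _, ?_⟩).tick.mono (by omega) fun _ => id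
      refine List.pairwise_cons.2 ⟨fun q' hq' => ?_, List.pairwise_cons.2 hL⟩
      rcases List.mem_cons.1 hq' with rfl | hq'
      · exact h
      · exact (hL.1 q' hq').trans h
    · refine ((ih hL.2).bind (c' := 1) fun M hM => (Sat.ret (c := 0) ?_).tick).tick.mono
        (by simp; omega) fun _ => id
      refine ⟨(hM.1.cons q).trans (.swap _ _ _), List.pairwise_cons.2 ⟨fun q' hq' => ?_, hM.2⟩⟩
      rcases List.mem_cons.1 (hM.1.mem_iff.1 hq') with rfl | hq'
      · exact (not_le.1 h).le
      · exact hL.1 q' hq'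

theorem sat_sortDesc (L : List (Fin n × ℝ)) :
    Sat E t (sortDesc L) (L.length * (2 * L.length + 1) + 1) fun M =>
      M.Perm L ∧ M.Pairwise fun q q' => q'.2 ≤ q.2 := by
  induction L with
  | nil => exact (Sat.ret (c := 0) (by simp)).tick
  | cons p L ih =>
    refine (ih.bind (c' := 2 * L.length + 1) fun M hM =>
      (sat_insertDesc p M hM.2).mono (by simp [hM.1.length_eq]) fun M' hM' =>
        ⟨hM'.1.trans (hM.1.cons p), hM'.2⟩).mono ?_ fun _ => id
    simp only [List.length_cons]
    nlinarith

theorem sat_agentsOf (L : List (Fin n × ℝ)) :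
    Sat E t (agentsOf L) (L.length + 1) fun S => S = L.map Prod.fst := by
  induction L with
  | nil => exact (Sat.ret (c := 0) (by simp)).tick
  | cons p L ih =>
    exact (ih.bind (c' := 1) fun S hS => (Sat.ret (c := 0) (by simp [hS])).tick)

theorem sat_dropFirst (r : ℕ) (L : List (Fin n × ℝ)) :
    Sat E t (dropFirst r L) (L.length + 1) fun S => S = (L.drop r).map Prod.fst := by
  induction r generalizing L with
  | zero => simpa [dropFirst] using sat_agentsOf L
  | succ r ih =>
    cases L with
    | nil => exact (Sat.ret (c := 0) (by simp)).tick
    | cons p L => exact (ih L).tick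

/-- `removeTop` removes `r` agents whose utilities for `a` are at least those of the others. -/
theorem sat_removeTop (a : U) (r : ℕ) (S : List (Fin n)) :
    Sat E t (removeTop a r S) (S.length * (2 * S.length + 1) + 3 * S.length + 3) fun S' =>
      ∃ D : List (Fin n), (D ++ S').Perm S ∧ S'.length = S.length - r ∧
        ∀ i ∈ D, ∀ i' ∈ S', E.util i' a ≤ E.util i a := by
  refine ((sat_askUtilities a S).bind (c' := S.length * (2 * S.length + 1) + 1 + (S.length + 1))
    fun L hL => Sat.mono ((sat_sortDesc L).bind (c' := S.length + 1) fun M hM =>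
      (sat_dropFirst r M).mono ?_ fun S' hS' => ?_) ?_ fun _ => id).mono ?_ fun _ => id
  · simp [hM.1.length_eq, hL]
  · have hmap : (M.map Prod.fst).Perm S := by
      simpa [hL, Function.comp_def] using hM.1.map Prod.fst
    have hval : ∀ q ∈ M, q.2 = E.util q.1 a := fun q hq => by
      have := hM.1.mem_iff.1 hq
      rw [hL, List.mem_map] at this
      obtain ⟨i, -, rfl⟩ := this
      rfl
    refine ⟨(M.take r).map Prod.fst, ?_, ?_, ?_⟩
    · rw [hS', ← List.map_append, List.take_append_drop]
      exact hmap
    · rw [hS', ← hmap.length_eq]; simp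
    · subst hS'
      simp only [List.mem_map]
      rintro _ ⟨q, hq, rfl⟩ _ ⟨q', hq', rfl⟩
      have h := hM.2
      rw [← List.take_append_drop r M, List.pairwise_append] at h
      rw [← hval q (List.mem_of_mem_take hq), ← hval q' (List.mem_of_mem_drop hq')]
      exact h.2.2 q hq q' hq'
  · simp [hL]
  · omega

end Subroutines

/-! ### Uniform convergence for sampling without replacement -/

section UniformConvergence

variable {α : Type u} [Fintype α] [DecidableEq α] {m : ℕ}

/-- Moment bound for random assignments of the two members of each pair to two samples. -/
theorem sum_signs_le (T : Finset (Fin m × Bool)) {s : ℝ} (hs : 0 ≤ s) (hs1 : s ≤ 1) :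
    ∑ τ : Fin m → Bool, (1 + s) ^ (Finset.univ.filter fun i => (i, τ i) ∈ T).card *
      (1 - s) ^ (Finset.univ.filter fun i => (i, !τ i) ∈ T).card ≤ 2 ^ m := by
  have h : ∀ τ : Fin m → Bool, (1 + s) ^ (Finset.univ.filter fun i => (i, τ i) ∈ T).card *
      (1 - s) ^ (Finset.univ.filter fun i => (i, !τ i) ∈ T).card =
      ∏ i, ((if (i, τ i) ∈ T then 1 + s else 1) * if (i, !τ i) ∈ T then 1 - s else 1) := by
    intro τ
    rw [Finset.prod_mul_distrib]
    simp [Finset.prod_ite]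
  simp_rw [h]
  rw [← Fintype.prod_sum fun (i : Fin m) (b : Bool) =>
    ((if (i, b) ∈ T then 1 + s else 1) * if (i, !b) ∈ T then 1 - s else 1)]
  -- The sum factors over the pairs. A pair with none, one or both members in `T` contributes `2`,
  -- `(1 + s) + (1 - s)` or `2 * (1 - s ^ 2)`.
  calc _ ≤ ∏ _i : Fin m, (2 : ℝ) := Finset.prod_le_prod
        (fun i _ => Finset.sum_nonneg fun b _ => by
          apply mul_nonneg <;> split_ifs <;> linarith) fun i _ => by
        simp only [Fintype.univ_bool, Finset.mem_singleton, Bool.true_eq_false, not_false_eq_true,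
          Finset.sum_insert, Bool.not_true, Finset.sum_singleton, Bool.not_false]
        split_ifs <;> nlinarith
    _ = 2 ^ m := by simp

theorem exp_le_one_add {s : ℝ} (hs : 0 ≤ s) : Real.exp (s - s ^ 2) ≤ 1 + s := by
  have h := Real.add_one_le_exp (-(s / (1 + s)))
  have h1 : -(s / (1 + s)) + 1 = (1 + s)⁻¹ := by field_simp; ring
  rw [h1, Real.exp_neg, inv_le_inv₀ (by positivity) (Real.exp_pos _)] at h
  refine (Real.exp_le_exp.2 ?_).trans h
  rw [le_div_iff₀ (by positivity)]
  nlinarith [pow_nonneg hs 3]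

theorem exp_le_one_sub {s : ℝ} (hs1 : s ≤ 1 / 2) :
    Real.exp (-(s + 2 * s ^ 2)) ≤ 1 - s := by
  have h0 : 0 < 1 - s := by linarith
  have h := Real.add_one_le_exp (s / (1 - s))
  have h1 : s / (1 - s) + 1 = (1 - s)⁻¹ := by field_simp; ring
  rw [h1, inv_le_comm₀ h0 (Real.exp_pos _), ← Real.exp_neg] at h
  refine (Real.exp_le_exp.2 ?_).trans h
  rw [neg_le_neg_iff, div_le_iff₀ h0]
  nlinarith [mul_nonneg (sq_nonneg s) (by linarith : 0 ≤ 1 - 2 * s)]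

/-- Few assignments of pairs are unbalanced. -/
theorem card_signs_mul_exp_le (T : Finset (Fin m × Bool)) {s H L : ℝ} (hs : 0 ≤ s)
    (hs1 : s ≤ 1 / 2) :
    ((Finset.univ.filter fun τ : Fin m → Bool =>
      H ≤ ((Finset.univ.filter fun i => (i, τ i) ∈ T).card : ℝ) ∧
      ((Finset.univ.filter fun i => (i, !τ i) ∈ T).card : ℝ) ≤ L).card : ℝ) *
      Real.exp ((s - s ^ 2) * H - (s + 2 * s ^ 2) * L) ≤ 2 ^ m := by
  refine le_trans ?_ (sum_signs_le T hs (by linarith))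
  -- Markov's inequality: each counted assignment contributes at least the exponential to the sum in
  -- `sum_signs_le`.
  rw [← nsmul_eq_mul]
  refine (Finset.card_nsmul_le_sum _ _ _ fun τ hτ => ?_).trans
    (Finset.sum_le_sum_of_subset_of_nonneg (Finset.subset_univ _) fun τ _ _ => ?_)
  · obtain ⟨ha, hb⟩ := (Finset.mem_filter.1 hτ).2
    rw [sub_eq_add_neg, Real.exp_add]
    gcongr
    · refine le_trans ?_ (pow_le_pow_left₀ (Real.exp_pos _).le (exp_le_one_add hs) _)
      rw [← Real.exp_nat_mul, mul_comm _ (s - s ^ 2)]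
      refine Real.exp_le_exp.2 (mul_le_mul_of_nonneg_left ha ?_)
      nlinarith
    · refine le_trans ?_ (pow_le_pow_left₀ (Real.exp_pos _).le (exp_le_one_sub hs1) _)
      rw [← Real.exp_nat_mul]
      refine Real.exp_le_exp.2 ?_
      have : 0 ≤ s + 2 * s ^ 2 := by positivity
      nlinarith
  · exact mul_nonneg (pow_nonneg (by linarith) _) (pow_nonneg (by linarith) _)

/-- The number of positions `i` of the sample `b` that are filled with members of `R`. -/
def hits (e : Fin m × Bool ↪ α) (b : Bool) (R : Finset α) (σ : Equiv.Perm α) : ℕ :=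
  (Finset.univ.filter fun i => σ (e (i, b)) ∈ R).card

/-- Exchanging the two members of the pairs selected by `τ`. -/
def exchange (τ : Fin m → Bool) : Equiv.Perm (Fin m × Bool) where
  toFun q := (q.1, xor (τ q.1) q.2)
  invFun q := (q.1, xor (τ q.1) q.2)
  left_inv q := by simp
  right_inv q := by simp

omit [Fintype α] in
/-- Sauer–Shelah for the traces of a family on finitely many distinct points. -/
theorem card_traces_le {ι : Type*} [Fintype ι] [DecidableEq ι] (𝓡 : Finset (Finset α))
    (x : ι ↪ α) :
    (𝓡.image fun R => Finset.univ.filter fun q => x q ∈ R).card ≤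
      ∑ i ∈ Finset.Iic 𝓡.vcDim, (Fintype.card ι).choose i := by
  refine (Finset.card_le_card_shatterer _).trans <|
    Finset.card_shatterer_le_sum_vcDim.trans <| Finset.sum_le_sum_of_subset <|
      Finset.Iic_subset_Iic.2 <| Finset.sup_le fun T hT => ?_
  rw [Finset.mem_shatterer] at hT
  rw [← Finset.card_map x]
  refine Finset.Shatters.card_le_vcDim fun V hV => ?_
  obtain ⟨W, hW, hTW⟩ := hT (t := T.filter fun q => x q ∈ V) (Finset.filter_subset _ _)
  obtain ⟨R, hR, rfl⟩ := Finset.mem_image.1 hW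
  refine ⟨R, hR, ?_⟩
  ext y
  constructor
  · intro hy
    obtain ⟨hy, hyR⟩ := Finset.mem_inter.1 hy
    obtain ⟨q, hq, rfl⟩ := Finset.mem_map.1 hy
    have : q ∈ T ∩ Finset.univ.filter fun q => x q ∈ R := by simp [hq, hyR]
    rw [hTW] at this
    exact (Finset.mem_filter.1 this).2
  · intro hy
    obtain ⟨q, hq, rfl⟩ := Finset.mem_map.1 (hV hy)
    have : q ∈ T ∩ Finset.univ.filter fun q => x q ∈ R := by
      rw [hTW]; exact Finset.mem_filter.2 ⟨hq, hy⟩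
    refine Finset.mem_inter.2 ⟨hV hy, ?_⟩
    simpa using (Finset.mem_inter.1 this).2

/-- Symmetrized deviation bound for a family of sets. -/
theorem card_unbalanced_mul_exp_le (e : Fin m × Bool ↪ α) (𝓡 : Finset (Finset α)) {s H L : ℝ}
    (hs : 0 ≤ s) (hs1 : s ≤ 1 / 2) :
    ((Finset.univ.filter fun σ : Equiv.Perm α =>
      ∃ R ∈ 𝓡, H ≤ hits e false R σ ∧ (hits e true R σ : ℝ) ≤ L).card : ℝ) *
      Real.exp ((s - s ^ 2) * H - (s + 2 * s ^ 2) * L) ≤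
    Fintype.card (Equiv.Perm α) * ∑ i ∈ Finset.Iic 𝓡.vcDim, (2 * m).choose i := by
  classical
  set G := Real.exp ((s - s ^ 2) * H - (s + 2 * s ^ 2) * L) with hG
  set Ev : Equiv.Perm α → Prop := fun σ =>
    ∃ R ∈ 𝓡, H ≤ hits e false R σ ∧ (hits e true R σ : ℝ) ≤ L with hEv
  set B : ℝ := ((∑ i ∈ Finset.Iic 𝓡.vcDim, (2 * m).choose i : ℕ) : ℝ) with hB
  let π : (Fin m → Bool) → Equiv.Perm α := fun τ => (exchange τ).viaFintypeEmbedding e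
  have hπ : ∀ τ q, π τ (e q) = e (q.1, xor (τ q.1) q.2) := fun τ q =>
    Equiv.Perm.viaFintypeEmbedding_apply_image _ _ _
  -- For fixed `σ` the exchanges only permute the `2 * m` sampled points, so a set matters only
  -- through its trace on them. The union bound therefore runs over traces, which Sauer–Shelah
  -- counts.
  have key : ∀ σ : Equiv.Perm α,
      ((Finset.univ.filter fun τ => Ev (σ * π τ)).card : ℝ) * G ≤ B * 2 ^ m := by
    intro σ
    let tr := 𝓡.image fun R => Finset.univ.filter fun q => (e.trans σ.toEmbedding) q ∈ R
    have htr : (tr.card : ℝ) ≤ B := by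
      have := card_traces_le 𝓡 (e.trans σ.toEmbedding)
      rw [Fintype.card_prod, Fintype.card_fin, Fintype.card_bool, mul_comm] at this
      rw [hB]
      exact_mod_cast this
    have hsub : (Finset.univ.filter fun τ => Ev (σ * π τ)) ⊆ tr.biUnion fun T =>
        Finset.univ.filter fun τ : Fin m → Bool =>
          H ≤ ((Finset.univ.filter fun i => (i, τ i) ∈ T).card : ℝ) ∧
          ((Finset.univ.filter fun i => (i, !τ i) ∈ T).card : ℝ) ≤ L := by
      intro τ hτ
      obtain ⟨R, hR, h1, h2⟩ := (Finset.mem_filter.1 hτ).2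
      refine Finset.mem_biUnion.2 ⟨_, Finset.mem_image_of_mem _ hR, ?_⟩
      simpa [hits, hπ] using And.intro h1 h2
    calc ((Finset.univ.filter fun τ => Ev (σ * π τ)).card : ℝ) * G
        ≤ (∑ T ∈ tr, (Finset.univ.filter fun τ : Fin m → Bool =>
          H ≤ ((Finset.univ.filter fun i => (i, τ i) ∈ T).card : ℝ) ∧
          ((Finset.univ.filter fun i => (i, !τ i) ∈ T).card : ℝ) ≤ L).card : ℕ) * G := by
          gcongr
          exact (Finset.card_le_card hsub).trans Finset.card_biUnion_le
      _ ≤ ∑ T ∈ tr, (2 : ℝ) ^ m := by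
          push_cast
          rw [Finset.sum_mul]
          exact Finset.sum_le_sum fun T _ => card_signs_mul_exp_le T hs hs1
      _ ≤ B * 2 ^ m := by
          rw [Finset.sum_const, nsmul_eq_mul]
          gcongr
  -- Right multiplication by `π τ` is a bijection, so every `τ` sees the same number of bad
  -- permutations.
  have hdouble : (2 : ℝ) ^ m * (Finset.univ.filter Ev).card =
      ∑ σ : Equiv.Perm α, ((Finset.univ.filter fun τ => Ev (σ * π τ)).card : ℝ) := by
    have h1 : ∀ τ, ((Finset.univ.filter Ev).card : ℝ) =
        ∑ σ : Equiv.Perm α, if Ev (σ * π τ) then 1 else 0 := fun τ => by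
      refine Eq.trans ?_ (Equiv.sum_comp (Equiv.mulRight (π τ)) fun σ =>
        if Ev σ then (1 : ℝ) else 0).symm
      rw [Finset.sum_boole]
    have h2 : ∀ σ, ((Finset.univ.filter fun τ => Ev (σ * π τ)).card : ℝ) =
        ∑ τ, if Ev (σ * π τ) then 1 else 0 := fun σ => by
      rw [Finset.sum_boole]
    simp_rw [h2]
    rw [Finset.sum_comm, ← Finset.sum_congr rfl fun τ _ => h1 τ]
    simp
  have : (2 : ℝ) ^ m * ((Finset.univ.filter Ev).card * G) ≤
      2 ^ m * (Fintype.card (Equiv.Perm α) * B) := by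
    calc _ = ∑ σ : Equiv.Perm α, ((Finset.univ.filter fun τ => Ev (σ * π τ)).card : ℝ) * G := by
          rw [← mul_assoc, hdouble, Finset.sum_mul]
      _ ≤ ∑ σ : Equiv.Perm α, B * 2 ^ m := Finset.sum_le_sum fun σ _ => key σ
      _ = _ := by simp; ring
  exact le_of_mul_le_mul_left this (by positivity)

/-- Conditioned on the first sample, each place of the second sample is filled uniformly from
the rest. -/
theorem sum_hits_second (e : Fin m × Bool ↪ α) (B : Equiv.Perm α → Prop)
    [DecidablePred B] (R : Equiv.Perm α → Finset α)
    (hB : ∀ σ σ' : Equiv.Perm α, (∀ i, σ (e (i, false)) = σ' (e (i, false))) → (B σ ↔ B σ'))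
    (hR : ∀ σ σ' : Equiv.Perm α, (∀ i, σ (e (i, false)) = σ' (e (i, false))) → R σ = R σ') :
    ((Fintype.card α : ℝ) - m) * ∑ σ ∈ Finset.univ.filter B, (hits e true (R σ) σ : ℝ) =
      m * ∑ σ ∈ Finset.univ.filter B, (((R σ).card : ℝ) - hits e false (R σ) σ) := by
  set P : Finset α := Finset.univ \ Finset.univ.image fun i => e (i, false) with hP
  have hinj : Function.Injective fun i => e (i, false) := fun i j h => by
    simpa using e.injective h
  have hPcard : (P.card : ℝ) = Fintype.card α - m := by
    rw [hP, Finset.card_sdiff_of_subset (Finset.subset_univ _), Finset.card_image_of_injective _ hinj,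
      Nat.cast_sub]
    · simp
    · rw [← Finset.card_image_of_injective _ hinj]; exact Finset.card_le_univ _
  let N : α → ℝ := fun p => ∑ σ ∈ Finset.univ.filter B, if σ p ∈ R σ then 1 else 0
  -- Precomposing with the transposition of two positions outside the first sample changes neither
  -- `B` nor `R`, so all these positions are equally likely to hit `R`.
  have hN : ∀ p ∈ P, ∀ q ∈ P, N p = N q := by
    intro p hp q hq
    have hfix : ∀ i, Equiv.swap p q (e (i, false)) = e (i, false) := fun i =>
      Equiv.swap_apply_of_ne_of_ne
        (by rintro rfl; simp [hP] at hp) (by rintro rfl; simp [hP] at hq)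
    have hB' : ∀ σ, B (σ * Equiv.swap p q) ↔ B σ := fun σ => hB _ _ fun i => by simp [hfix]
    have hR' : ∀ σ, R (σ * Equiv.swap p q) = R σ := fun σ => hR _ _ fun i => by simp [hfix]
    simp only [N, Finset.sum_filter]
    rw [← Equiv.sum_comp (Equiv.mulRight (Equiv.swap p q))]
    refine Finset.sum_congr rfl fun σ _ => ?_
    simp [hB', hR']
  have h1 : ∀ q ∈ P, (P.card : ℝ) * N q =
      ∑ σ ∈ Finset.univ.filter B, (((R σ).card : ℝ) - hits e false (R σ) σ) := by
    intro q hq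
    rw [← nsmul_eq_mul, ← Finset.sum_const, ← Finset.sum_congr rfl fun p hp => hN p hp q hq]
    simp only [N]
    rw [Finset.sum_comm]
    refine Finset.sum_congr rfl fun σ _ => ?_
    have h2 : (∑ p : α, if σ p ∈ R σ then (1 : ℝ) else 0) = (R σ).card := by
      rw [Equiv.sum_comp σ fun y => if y ∈ R σ then (1 : ℝ) else 0]
      simp
    have h3 : (∑ p ∈ Finset.univ.image fun i => e (i, false), if σ p ∈ R σ then (1 : ℝ) else 0) =
        hits e false (R σ) σ := by
      rw [Finset.sum_image fun i _ j _ h => hinj h]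
      simp [hits]
    rw [← h2, ← h3, hP]
    exact Finset.sum_sdiff_eq_sub (Finset.subset_univ _)
  have h4 : ∑ σ ∈ Finset.univ.filter B, (hits e true (R σ) σ : ℝ) = ∑ i, N (e (i, true)) := by
    simp only [N]
    rw [Finset.sum_comm]
    refine Finset.sum_congr rfl fun σ _ => ?_
    simp [hits]
  rw [h4, ← hPcard, Finset.mul_sum, Finset.sum_congr rfl fun i _ => h1 _ (by simp [hP]), Finset.sum_const,
    Finset.card_fin, nsmul_eq_mul]

end UniformConvergence

/-! ### Tail bounds for one sample, by comparison with a second sample. -/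

section DeviationBounds

variable {α : Type u} [Fintype α] [DecidableEq α] {m : ℕ}

/-- For `i ≤ d` the weight `x ^ i * x⁻¹ ^ d` is at least `1`; inserting it turns the sum into part
of a binomial expansion of `(x + 1) ^ N`. A small `x` keeps the exponential factor harmless. -/
theorem sum_choose_le_exp (N : ℕ) {v d : ℕ} (hv : v ≤ d) {x : ℝ} (hx : 0 < x) (hx1 : x ≤ 1) :
    ((∑ i ∈ Finset.Iic v, N.choose i : ℕ) : ℝ) ≤ Real.exp (N * x) * x⁻¹ ^ d := by
  have h1 : ∀ i ∈ Finset.Iic v, (N.choose i : ℝ) ≤ x ^ i * N.choose i * x⁻¹ ^ d := fun i hi => by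
    have hi : i ≤ d := (Finset.mem_Iic.1 hi).trans hv
    have h2 : 1 ≤ x ^ i * x⁻¹ ^ d := by
      rw [inv_pow, ← div_eq_mul_inv, one_le_div (by positivity)]
      exact pow_le_pow_of_le_one hx.le hx1 hi
    calc (N.choose i : ℝ) = N.choose i * 1 := (mul_one _).symm
      _ ≤ N.choose i * (x ^ i * x⁻¹ ^ d) := by gcongr
      _ = _ := by ring
  have h3 : ∑ i ∈ Finset.Iic v, x ^ i * (N.choose i : ℝ) ≤ (x + 1) ^ N := by
    rw [add_pow]
    simp only [one_pow, mul_one]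
    rw [Finset.sum_subset (Finset.subset_union_left (s₁ := Finset.range (N + 1))
      (s₂ := Finset.Iic v)) fun i _ hi => by
        rw [Nat.choose_eq_zero_of_lt (by simpa [Nat.lt_succ_iff] using hi)]; simp]
    exact Finset.sum_le_sum_of_subset_of_nonneg Finset.subset_union_right fun i _ _ => by positivity
  push_cast
  refine (Finset.sum_le_sum h1).trans ?_
  rw [← Finset.sum_mul]
  gcongr
  refine h3.trans ?_
  rw [Real.exp_nat_mul]
  gcongr
  exact Real.add_one_le_exp x

/-- The choice `s = 1 / (48 * k)` makes the linear gain `s * m * eps k / 2` twice `m / (768 * k ^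
3)`, while the quadratic loss `3 * s ^ 2 * H` is at most once that number, because `H ≤ m / k`. -/
theorem exponent_ge {k : ℕ} (hk : 1 ≤ k) {H : ℝ} (hH : H ≤ m / k) :
    (m : ℝ) / (768 * k ^ 3) ≤
      (1 / (48 * k : ℝ) - (1 / (48 * k : ℝ)) ^ 2) * H -
        (1 / (48 * k : ℝ) + 2 * (1 / (48 * k : ℝ)) ^ 2) * (H - m * eps k / 2) := by
  have hk' : (0 : ℝ) < k := by exact_mod_cast hk
  have h1 : 3 * (1 / (48 * k : ℝ)) ^ 2 * H ≤ 3 * (1 / (48 * k : ℝ)) ^ 2 * (m / k) := by gcongr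
  have h2 : 3 * (1 / (48 * k : ℝ)) ^ 2 * (m / k) = m / (768 * k ^ 3) := by field_simp; ring
  have h3 : 1 / (48 * k : ℝ) * (m * eps k / 2) = 2 * (m / (768 * k ^ 3)) := by
    unfold eps; field_simp; ring
  have h4 : 0 ≤ 2 * (1 / (48 * k : ℝ)) ^ 2 * (m * eps k / 2) := by unfold eps; positivity
  nlinarith

theorem card_unbalanced_le (e : Fin m × Bool ↪ α) (𝓡 : Finset (Finset α)) {k : ℕ} (hk : 1 ≤ k)
    {H : ℝ} (hH : H ≤ m / k) :
    ((Finset.univ.filter fun σ : Equiv.Perm α =>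
      ∃ R ∈ 𝓡, H ≤ hits e false R σ ∧ (hits e true R σ : ℝ) ≤ H - m * eps k / 2).card : ℝ) ≤
    Fintype.card (Equiv.Perm α) * ((∑ i ∈ Finset.Iic 𝓡.vcDim, (2 * m).choose i : ℕ) *
      Real.exp (-(m / (768 * k ^ 3)))) := by
  have hk' : (1 : ℝ) ≤ k := by exact_mod_cast hk
  have h := card_unbalanced_mul_exp_le e 𝓡 (s := 1 / (48 * k : ℝ)) (H := H)
    (L := H - m * eps k / 2) (by positivity) (by
      rw [div_le_div_iff₀ (by positivity) (by norm_num)]; linarith)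
  rw [← mul_assoc, Real.exp_neg, ← div_eq_mul_inv, le_div_iff₀ (Real.exp_pos _)]
  refine le_trans ?_ h
  gcongr
  exact exponent_ge hk hH

theorem two_mul_eps_le {k : ℕ} (hk : 1 ≤ k) : 2 * eps k ≤ 1 / k := by
  have hk' : (1 : ℝ) ≤ k := by exact_mod_cast hk
  unfold eps
  rw [mul_one_div, div_le_div_iff₀ (by positivity) (by positivity)]
  nlinarith

theorem eps_pos {k : ℕ} (hk : 1 ≤ k) : 0 < eps k := by
  have hk' : (1 : ℝ) ≤ k := by exact_mod_cast hk
  unfold eps; positivity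

/-- Uniformly over a family of small sets, the sample is unlikely to contain too many members. -/
theorem card_overrepresented_le (e : Fin m × Bool ↪ α) (𝓡 : Finset (Finset α)) {d k : ℕ}
    (hk : 1 ≤ k) (hd : 𝓡.vcDim ≤ d) (hm : 0 < m) (hmα : m < Fintype.card α) :
    ((Finset.univ.filter fun σ : Equiv.Perm α => ∃ R ∈ 𝓡,
      (R.card : ℝ) ≤ Fintype.card α * (1 / k - 2 * eps k) ∧
        m * (1 / k - eps k) ≤ hits e false R σ).card : ℝ) ≤
    Fintype.card (Equiv.Perm α) *
      (8 * k * ((3072 * k ^ 3) ^ d * Real.exp (-(m / (1536 * k ^ 3))))) := by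
  classical
  have hk' : (1 : ℝ) ≤ k := by exact_mod_cast hk
  have hε := eps_pos hk
  have hε2 := two_mul_eps_le hk
  set B : Equiv.Perm α → Prop := fun σ => ∃ R ∈ 𝓡,
      (R.card : ℝ) ≤ Fintype.card α * (1 / k - 2 * eps k) ∧
        m * (1 / k - eps k) ≤ hits e false R σ with hBdef
  let P : (Fin m → α) → Finset α → Prop := fun x R => R ∈ 𝓡 ∧
      (R.card : ℝ) ≤ Fintype.card α * (1 / k - 2 * eps k) ∧
        m * (1 / k - eps k) ≤ ((Finset.univ.filter fun i => x i ∈ R).card : ℝ)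
  have hBP : ∀ σ, B σ ↔ ∃ R, P (fun i => σ (e (i, false))) R := fun σ => Iff.rfl
  -- The violating set is selected from the first sample alone, so that `sum_hits_second` applies to
  -- it.
  let R₀ : (Fin m → α) → Finset α := fun x => if h : ∃ R, P x R then h.choose else ∅
  have hR₀ : ∀ σ, B σ → P (fun i => σ (e (i, false))) (R₀ fun i => σ (e (i, false))) := by
    intro σ hσ
    have h := (hBP σ).1 hσ
    simp only [R₀, dif_pos h]
    exact h.choose_spec
  set R : Equiv.Perm α → Finset α := fun σ => R₀ fun i => σ (e (i, false)) with hRdef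
  have hsum := sum_hits_second e B R
    (fun σ σ' h => by rw [hBP, hBP]; simp only [h]) (fun σ σ' h => by simp only [hRdef, h])
  set b : ℝ := ((Finset.univ.filter B).card : ℝ) with hb
  set L : ℝ := m * (1 / k - eps k) - m * eps k / 2 with hL
  set good := Finset.univ.filter fun σ : Equiv.Perm α =>
      ∃ R ∈ 𝓡, m * (1 / k - eps k) ≤ hits e false R σ ∧ (hits e true R σ : ℝ) ≤ L with hgood
  have hmα' : (0 : ℝ) < Fintype.card α - m := by
    have : (m : ℝ) < Fintype.card α := by exact_mod_cast hmα
    linarith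
  have hm' : (0 : ℝ) < m := by exact_mod_cast hm
  -- A first sample with more than its share of `R` leaves density at most `1 / k - 2 * eps k`
  -- outside, which bounds the mean of the second sample.
  have hup : ∑ σ ∈ Finset.univ.filter B, (hits e true (R σ) σ : ℝ) ≤
      m * (1 / k - 2 * eps k) * b := by
    refine le_of_mul_le_mul_left ?_ hmα'
    rw [hsum]
    have : ∑ σ ∈ Finset.univ.filter B, (((R σ).card : ℝ) - hits e false (R σ) σ) ≤
        b * ((Fintype.card α - m) * (1 / k - 2 * eps k)) := by
      refine (Finset.sum_le_card_nsmul _ _ ((Fintype.card α - m) * (1 / k - 2 * eps k))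
        fun σ hσ => ?_).trans_eq (nsmul_eq_mul _ _)
      obtain ⟨-, h1, h2⟩ := hR₀ σ (Finset.mem_filter.1 hσ).2
      have h3 : (m : ℝ) * (1 / k - eps k) ≤ hits e false (R σ) σ := h2
      have h4 : ((R σ).card : ℝ) ≤ Fintype.card α * (1 / k - 2 * eps k) := h1
      nlinarith
    calc _ ≤ (m : ℝ) * (b * ((Fintype.card α - m) * (1 / k - 2 * eps k))) := by gcongr
      _ = _ := by ring
  have hlow : L * (b - good.card) ≤ ∑ σ ∈ Finset.univ.filter B, (hits e true (R σ) σ : ℝ) := by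
    have hL0 : 0 ≤ L := by
      rw [hL, ← sub_nonneg]
      nlinarith
    have h1 : b ≤ good.card + ((Finset.univ.filter B).filter fun σ =>
        L ≤ hits e true (R σ) σ).card := by
      rw [hb, ← Nat.cast_add, Nat.cast_le]
      refine (Finset.card_le_card ?_).trans (Finset.card_union_le _ _)
      intro σ hσ
      obtain ⟨h0, -, h2⟩ := hR₀ σ (Finset.mem_filter.1 hσ).2
      rcases le_total L (hits e true (R σ) σ : ℝ) with h | h
      · exact Finset.mem_union_right _ (Finset.mem_filter.2 ⟨hσ, h⟩)
      · exact Finset.mem_union_left _ (Finset.mem_filter.2 ⟨Finset.mem_univ _, R σ, h0, h2, h⟩)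
    calc L * (b - good.card) ≤ L * ((Finset.univ.filter B).filter fun σ =>
          L ≤ hits e true (R σ) σ).card := mul_le_mul_of_nonneg_left (by linarith) hL0
      _ ≤ ∑ σ ∈ (Finset.univ.filter B).filter fun σ => L ≤ hits e true (R σ) σ,
            (hits e true (R σ) σ : ℝ) := by
          rw [mul_comm, ← nsmul_eq_mul]
          exact Finset.card_nsmul_le_sum _ _ _ fun σ hσ => (Finset.mem_filter.1 hσ).2
      _ ≤ _ := Finset.sum_le_sum_of_subset_of_nonneg (Finset.filter_subset _ _)
          fun σ _ _ => Nat.cast_nonneg _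
  -- The threshold `L` exceeds the mean bound by `m * eps k / 2`, and `L ≤ m / k`. So a share of at
  -- least `(eps k / 2) / (1 / k) = 1 / (8 * k)` of the bad permutations is unbalanced.
  have hbg : b ≤ 8 * k * good.card := by
    have h1 : m * (eps k / 2) * b ≤ L * good.card := by rw [hL] at hlow ⊢; nlinarith
    have h2 : L * good.card ≤ m * (1 / k) * good.card := by
      gcongr
      rw [hL]; nlinarith
    have h3 : (eps k / 2) * b ≤ (1 / k) * good.card :=
      le_of_mul_le_mul_left (by linarith) hm'
    have h4 : eps k / 2 = (1 / k) * (1 / (8 * k)) := by unfold eps; field_simp; norm_num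
    rw [h4, mul_assoc] at h3
    have h5 := le_of_mul_le_mul_left h3 (by positivity)
    rw [one_div, inv_mul_le_iff₀ (by positivity)] at h5
    exact h5
  have hfin := card_unbalanced_le e 𝓡 hk (H := m * (1 / k - eps k)) (by
    rw [div_eq_mul_one_div (m : ℝ)]; gcongr; linarith)
  -- With this `x` the factor `exp (2 * m * x)` uses up exactly half of the exponent `m / (768 * k ^
  -- 3)`.
  have hch := sum_choose_le_exp (2 * m) hd (x := 1 / (3072 * k ^ 3)) (by positivity) (by
    rw [div_le_one (by positivity)]
    have := one_le_pow₀ hk' (n := 3)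
    linarith)
  calc b ≤ 8 * k * good.card := hbg
    _ ≤ 8 * k * (Fintype.card (Equiv.Perm α) *
        (Real.exp ((2 * m : ℕ) * (1 / (3072 * k ^ 3))) * (1 / (3072 * k ^ 3) : ℝ)⁻¹ ^ d *
          Real.exp (-(m / (768 * k ^ 3))))) := by
        gcongr
        refine hfin.trans ?_
        gcongr
    _ = _ := by
        have : Real.exp (-(m / (1536 * k ^ 3))) =
            Real.exp ((2 * m : ℕ) * (1 / (3072 * k ^ 3))) * Real.exp (-(m / (768 * k ^ 3))) := by
          rw [← Real.exp_add]
          congr 1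
          push_cast
          field_simp
          norm_num
        rw [this, one_div, inv_inv]
        ring

theorem vcDim_singleton {α : Type*} [DecidableEq α] (R : Finset α) :
    ({R} : Finset (Finset α)).vcDim = 0 := by
  refine Nat.le_zero.1 (Finset.sup_le fun T hT => ?_)
  rw [Finset.mem_shatterer] at hT
  obtain ⟨u, hu, h1⟩ := hT (Finset.empty_subset T)
  obtain ⟨v, hv, h2⟩ := hT (Finset.Subset.refl T)
  rw [Finset.mem_singleton] at hu hv
  subst hu hv
  rw [← h2, h1]
  simp

/-- The sample is unlikely to contain too few members of a given large set. -/
theorem card_underrepresented_le (e : Fin m × Bool ↪ α) (R : Finset α) {k : ℕ}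
    (hk : 1 ≤ k) (hR : (Fintype.card α : ℝ) / k ≤ R.card) (hm : 0 < m)
    (hmα : m < Fintype.card α) :
    ((Finset.univ.filter fun σ : Equiv.Perm α =>
      (hits e false R σ : ℝ) < m * (1 / k - eps k)).card : ℝ) ≤
    Fintype.card (Equiv.Perm α) * (8 * k ^ 2 * Real.exp (-(m / (768 * k ^ 3)))) := by
  classical
  have hk' : (1 : ℝ) ≤ k := by exact_mod_cast hk
  have hε := eps_pos hk
  set B : Equiv.Perm α → Prop := fun σ => (hits e false R σ : ℝ) < m * (1 / k - eps k) with hBdef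
  have hsum := sum_hits_second e B (fun _ => R)
    (fun σ σ' h => by simp only [hBdef, hits, h]) (fun σ σ' h => rfl)
  set b : ℝ := ((Finset.univ.filter B).card : ℝ) with hb
  set H : ℝ := m * (1 / k - eps k / 2) with hH
  -- The samples trade roles: here the first is poor in `R` and the second rich, while
  -- `card_unbalanced_le` treats the opposite case.
  let e' : Fin m × Bool ↪ α := ((Equiv.refl _).prodCongr Equiv.boolNot).toEmbedding.trans e
  set good := Finset.univ.filter fun σ : Equiv.Perm α =>
      ∃ R' ∈ ({R} : Finset (Finset α)), H ≤ hits e' false R' σ ∧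
        (hits e' true R' σ : ℝ) ≤ H - m * eps k / 2 with hgood
  have hmα' : (0 : ℝ) < Fintype.card α - m := by
    have : (m : ℝ) < Fintype.card α := by exact_mod_cast hmα
    linarith
  have hm' : (0 : ℝ) < m := by exact_mod_cast hm
  have hlow : m * (1 / k) * b ≤ ∑ σ ∈ Finset.univ.filter B, (hits e true R σ : ℝ) := by
    refine le_of_mul_le_mul_left ?_ hmα'
    rw [hsum]
    have : b * ((Fintype.card α - m) * (1 / k)) ≤
        ∑ σ ∈ Finset.univ.filter B, ((R.card : ℝ) - hits e false R σ) := by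
      rw [hb, ← nsmul_eq_mul]
      refine Finset.card_nsmul_le_sum _ _ _ fun σ hσ => ?_
      have h2 : (hits e false R σ : ℝ) < m * (1 / k - eps k) := (Finset.mem_filter.1 hσ).2
      rw [div_eq_mul_one_div] at hR
      nlinarith
    calc _ = (m : ℝ) * (b * ((Fintype.card α - m) * (1 / k))) := by ring
      _ ≤ _ := by gcongr
  have hup : ∑ σ ∈ Finset.univ.filter B, (hits e true R σ : ℝ) ≤ m * good.card + H * b := by
    have h1 : ∀ σ ∈ Finset.univ.filter B,
        (hits e true R σ : ℝ) ≤ m * (if σ ∈ good then 1 else 0) + H := by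
      intro σ hσ
      have hBσ : (hits e false R σ : ℝ) < m * (1 / k - eps k) := (Finset.mem_filter.1 hσ).2
      have hH0 : 0 ≤ H := by
        have := two_mul_eps_le hk
        exact mul_nonneg hm'.le (by linarith)
      by_cases h : H ≤ hits e true R σ
      · have : σ ∈ good := Finset.mem_filter.2 ⟨Finset.mem_univ _, R, Finset.mem_singleton_self _,
          by simpa [hits, e'] using h, by
            have h3 : (hits e' true R σ : ℝ) = hits e false R σ := by simp [hits, e']
            rw [h3, hH]; linarith⟩
        have h4 : (hits e true R σ : ℝ) ≤ m := by
          have : hits e true R σ ≤ m := (Finset.card_le_univ _).trans_eq (Fintype.card_fin m)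
          exact_mod_cast this
        rw [if_pos this]; linarith
      · have : (0 : ℝ) ≤ m * (if σ ∈ good then 1 else 0) := by positivity
        linarith
    refine (Finset.sum_le_sum h1).trans ?_
    rw [Finset.sum_add_distrib, Finset.sum_const, ← Finset.mul_sum, nsmul_eq_mul, mul_comm H]
    gcongr
    rw [Finset.sum_boole]
    gcongr
    exact fun σ hσ => (Finset.mem_filter.1 hσ).2
  -- The second sample has mean at least `m / k`, which exceeds `H` by `m * eps k / 2`. Bounding the
  -- hits on `good` crudely by `m` yields the share `eps k / 2 = 1 / (8 * k ^ 2)`.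
  have hbg : b ≤ 8 * k ^ 2 * good.card := by
    have h1 : m * (eps k / 2 * b) ≤ m * good.card := by rw [hH] at hup; nlinarith
    have h3 := le_of_mul_le_mul_left h1 hm'
    have h4 : eps k / 2 = (8 * k ^ 2 : ℝ)⁻¹ := by unfold eps; field_simp; norm_num
    rwa [h4, inv_mul_le_iff₀ (by positivity)] at h3
  have hfin := card_unbalanced_le e' {R} hk (H := H) (by
    rw [div_eq_mul_one_div, hH]; gcongr; linarith)
  rw [vcDim_singleton] at hfin
  have h0 : (∑ i ∈ Finset.Iic 0, (2 * m).choose i) = 1 := by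
    rw [show (Finset.Iic 0 : Finset ℕ) = {0} from rfl]; simp
  rw [h0, Nat.cast_one, one_mul] at hfin
  calc b ≤ 8 * k ^ 2 * good.card := hbg
    _ ≤ 8 * k ^ 2 * (Fintype.card (Equiv.Perm α) * Real.exp (-(m / (768 * k ^ 3)))) := by gcongr
    _ = _ := by ring

end DeviationBounds

/-! ### The distribution of a sample -/

section Sampling

variable {n : ℕ} {U : Type u} {E : Env n U}

/-- In a list without duplicates at most one position yields the prescribed head, so each draw
contributes one factor of the falling factorial. An upper bound on point probabilities is all that
the union bound in `psat_sample` needs. -/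
theorem psat_sample_ne (m : ℕ) (L : List (Fin n)) (hL : L.Nodup) (hm : m ≤ L.length)
    (X : List (Fin n)) :
    PSat E (sample m L) ((L.length.descFactorial m : ENNReal)⁻¹) fun Y => Y ≠ X := by
  induction m generalizing L X with
  | zero =>
    intro h
    simpa using ((run E (sample 0 L) h).toOuterMeasure.mono (Set.subset_univ _)).trans_eq <|
      (PMF.toOuterMeasure_apply_eq_one_iff _ _).2 (Set.subset_univ _)
  | succ m ih =>
    cases L with
    | nil => simp at hm
    | cons a L =>
      simp only [List.length_cons] at hm
      cases X with
      | nil =>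
        refine (PSat.zero_of_sat (t := 0) ((sat_sample (m + 1) (a :: L) hm _ le_rfl).mono le_rfl
          fun Y hY => ?_)).mono (zero_le) fun _ => id
        rintro rfl
        simp at hY
      | cons y X =>
        have hidx : ∀ x : Fin (L.length + 1), PSat E ((extract (U := U) a L x).bind fun q =>
            (sample m q.2).bind fun X => .tick (.ret (q.1 :: X)))
            (if (a :: L)[x]? = some y then (L.length.descFactorial m : ENNReal)⁻¹ else 0)
            fun Y => Y ≠ y :: X := fun x => by
          refine (sat_extract (t := 0) a L x (by omega)).bind_psat fun q hq => ?_
          obtain ⟨hx, hq1⟩ := List.getElem?_eq_some_iff.1 hq.1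
          have hlen : q.2.length = L.length := by
            rw [hq.2, List.length_eraseIdx_of_lt hx]; simp
          have hnd : q.2.Nodup := hq.2 ▸ hL.sublist (List.eraseIdx_sublist _ _)
          by_cases hxy : (a :: L)[x]? = some y
          · rw [if_pos hxy]
            refine ((ih q.2 hnd (by omega) X).bind (η' := 0) fun Y hY =>
              PSat.tick (PSat.zero_of_sat (t := 0) (Sat.ret (c := 0) ?_))).mono
                (by simp [hlen]) fun _ => id
            simp [hY]
          · rw [if_neg hxy]
            refine (sat_sample (t := 0) m q.2 (by omega) _ le_rfl).bind_psat fun Y _ =>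
              PSat.tick (PSat.zero_of_sat (t := 0) (Sat.ret (c := 0) ?_))
            have : q.1 ≠ y := fun h => hxy (h ▸ hq.1)
            simp [this]
        refine (PSat.draw hidx).mono ?_ fun _ => id
        rw [List.length_cons, Nat.succ_descFactorial_succ, Nat.cast_mul,
          ENNReal.mul_inv (Or.inl (by simp)) (Or.inl (ENNReal.natCast_ne_top _))]
        push_cast
        gcongr
        rw [← Finset.sum_filter]
        refine (Finset.sum_le_card_nsmul _ _ _ fun x _ => le_rfl).trans ?_
        refine (nsmul_le_nsmul_left (zero_le) (m := 1) ?_).trans_eq (one_nsmul _)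
        refine Finset.card_le_one.2 fun x hx x' hx' => ?_
        have h1 := (Finset.mem_filter.1 hx).2
        have h2 := (Finset.mem_filter.1 hx').2
        exact Fin.ext ((List.getElem?_inj (by simp; omega) hL).1 (h1.trans h2.symm))

/-- Permutations act transitively on injective `m`-tuples, so the number of `σ` carrying `e` into
`P` does not depend on `e`. Averaging over all tuples and summing in both orders transfers uniform
permutations to uniform samples. -/
theorem card_filter_trans {α : Type*} [Fintype α] [DecidableEq α] {m : ℕ} (e : Fin m ↪ α)
    (P : (Fin m ↪ α) → Prop) [DecidablePred P] :
    Fintype.card (Fin m ↪ α) *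
        (Finset.univ.filter fun σ : Equiv.Perm α => P (e.trans σ.toEmbedding)).card =
      Fintype.card (Equiv.Perm α) * (Finset.univ.filter P).card := by
  have h1 : ∀ f : Fin m ↪ α,
      (Finset.univ.filter fun σ : Equiv.Perm α => P (e.trans σ.toEmbedding)).card =
        ∑ σ : Equiv.Perm α, if P (f.trans σ.toEmbedding) then 1 else 0 := by
    intro f
    have := Equiv.Perm.isMultiplyPretransitive α m
    obtain ⟨ρ, rfl⟩ := MulAction.exists_smul_eq (Equiv.Perm α) f e
    refine Eq.trans ?_ (Equiv.sum_comp (Equiv.mulRight ρ) fun σ =>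
        if P (f.trans σ.toEmbedding) then 1 else 0)
    rw [Finset.card_filter]
    rfl
  have h2 : ∀ σ : Equiv.Perm α, (Finset.univ.filter P).card =
      ∑ f : Fin m ↪ α, if P (f.trans σ.toEmbedding) then 1 else 0 := by
    intro σ
    refine Eq.trans ?_ (Equiv.sum_comp
      (Equiv.embeddingCongr (Equiv.refl (Fin m)) σ) fun f => if P f then 1 else 0).symm
    rw [Finset.card_filter]
  calc _ = ∑ f : Fin m ↪ α, ∑ σ : Equiv.Perm α, if P (f.trans σ.toEmbedding) then 1 else 0 := by
        rw [← Finset.sum_congr rfl fun f _ => h1 f]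
        simp
    _ = _ := by
        rw [Finset.sum_comm, ← Finset.sum_congr rfl fun σ _ => h2 σ]
        simp

/-- A bound on the number of permutations whose initial segment is bad bounds the probability of
a bad sample. -/
theorem psat_sample {m : ℕ} (hm : m ≤ n) (e : Fin m ↪ Fin n) {G : List (Fin n) → Prop}
    [DecidablePred G] {η : ℝ}
    (hG : ((Finset.univ.filter fun σ : Equiv.Perm (Fin n) =>
      ¬ G (List.ofFn fun i => σ (e i))).card : ℝ) ≤ Fintype.card (Equiv.Perm (Fin n)) * η) :
    PSat E (sample m (List.finRange n)) (ENNReal.ofReal η) G := by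
  classical
  intro h
  set bad := Finset.univ.filter fun f : Fin m ↪ Fin n => ¬ G (List.ofFn f) with hbad
  have hcount : (bad.card : ℝ) ≤ Fintype.card (Fin m ↪ Fin n) * η := by
    have h1 : Fintype.card (Fin m ↪ Fin n) * (Finset.univ.filter
        fun σ : Equiv.Perm (Fin n) => ¬ G (List.ofFn fun i => σ (e i))).card =
        Fintype.card (Equiv.Perm (Fin n)) * bad.card :=
      card_filter_trans e fun f => ¬ G (List.ofFn f)
    have h2 : (Fintype.card (Fin m ↪ Fin n) : ℝ) * ((Finset.univ.filter
        fun σ : Equiv.Perm (Fin n) => ¬ G (List.ofFn fun i => σ (e i))).card : ℝ) =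
        (Fintype.card (Equiv.Perm (Fin n)) : ℝ) * (bad.card : ℝ) := by
      rw [← Nat.cast_mul, h1, Nat.cast_mul]
    have h3 : (0 : ℝ) < Fintype.card (Equiv.Perm (Fin n)) := by
      exact_mod_cast Fintype.card_pos
    refine le_of_mul_le_mul_left ?_ h3
    rw [← h2]
    calc _ ≤ (Fintype.card (Fin m ↪ Fin n) : ℝ) * (Fintype.card (Equiv.Perm (Fin n)) * η) := by
          gcongr
      _ = _ := by ring
  have hlen : (List.finRange n).length = n := List.length_finRange
  have hcard : Fintype.card (Fin m ↪ Fin n) = n.descFactorial m := by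
    simp [Fintype.card_embedding_eq]
  have hpos : 0 < n.descFactorial m := Nat.pos_of_ne_zero fun h0 =>
    absurd (Nat.descFactorial_eq_zero_iff_lt.1 h0) (not_lt.2 hm)
  calc (run E (sample m (List.finRange n)) h).toOuterMeasure {o | ¬ G o.1}
      ≤ (run E (sample m (List.finRange n)) h).toOuterMeasure
          (⋃ f ∈ bad, {o | ¬ o.1 ≠ List.ofFn f}) := by
        refine PMF.toOuterMeasure_mono _ ?_
        rintro o ⟨ho, ho'⟩
        obtain ⟨h1, h2⟩ := (sat_sample (t := 0) m (List.finRange n) (by omega) _ le_rfl h o ho').1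
        have hnd : o.1.Nodup := by
          obtain ⟨l, hl, hl'⟩ := h2
          exact hl.nodup_iff.1 ((List.nodup_finRange n).sublist hl')
        have hofFn : List.ofFn (fun i : Fin m => o.1[i]'(by omega)) = o.1 :=
          List.ext_getElem (by simp [h1]) (by simp)
        refine Set.mem_iUnion₂.2 ⟨⟨fun i : Fin m => o.1[i]'(by omega), fun i j hij => ?_⟩, ?_, ?_⟩
        · exact Fin.ext ((hnd.getElem_inj_iff).1 hij)
        · refine Finset.mem_filter.2 ⟨Finset.mem_univ _, ?_⟩
          show ¬ G (List.ofFn fun i : Fin m => o.1[i]'(by omega))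
          rw [hofFn]; exact ho
        · show ¬ o.1 ≠ List.ofFn fun i : Fin m => o.1[i]'(by omega)
          rw [hofFn]; simp
    _ ≤ ∑ f ∈ bad, (run E (sample m (List.finRange n)) h).toOuterMeasure
          {o | ¬ o.1 ≠ List.ofFn f} := MeasureTheory.measure_biUnion_finset_le _ _
    _ ≤ bad.card • ((n.descFactorial m : ENNReal)⁻¹) := by
        refine Finset.sum_le_card_nsmul _ _ _ fun f _ => ?_
        have := psat_sample_ne (E := E) m (List.finRange n) (List.nodup_finRange n) (by omega)
          (List.ofFn f) h
        rwa [hlen] at this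
    _ ≤ ENNReal.ofReal η := by
        rw [nsmul_eq_mul, ← div_eq_mul_inv]
        refine ENNReal.div_le_of_le_mul ?_
        rw [hcard, mul_comm] at hcount
        rw [← ENNReal.ofReal_natCast, ← ENNReal.ofReal_natCast (n.descFactorial m),
          ← ENNReal.ofReal_mul' (Nat.cast_nonneg _)]
        exact ENNReal.ofReal_le_ofReal hcount

end Sampling

/-! ### Generative queries and thresholds -/

section Thresholds

theorem lt_length_filter_iff {θ : ℝ} (l : List ℝ) (hl : l.Pairwise (· ≥ ·)) (s : ℕ) :
    s < (l.filter (θ ≤ ·)).length ↔ ∃ x, l[s]? = some x ∧ θ ≤ x := by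
  induction l generalizing s with
  | nil => simp
  | cons a l ih =>
    rw [List.pairwise_cons] at hl
    by_cases ha : θ ≤ a
    · cases s with
      | zero => simp [ha]
      | succ s => simpa [ha] using ih hl.2 s
    · have hall : ∀ x ∈ a :: l, ¬ θ ≤ x := fun x hx => by
        rcases List.mem_cons.1 hx with rfl | hx
        · exact ha
        · exact fun h => ha (h.trans (hl.1 x hx))
      rw [List.filter_eq_nil_iff.2 (by simpa using hall)]
      simp only [List.length_nil, not_lt_zero, false_iff, not_exists, not_and]
      exact fun x hx => hall x (List.mem_of_getElem? hx)

theorem le_rthLargest_iff {θ : ℝ} {r : ℕ} (hr : 0 < r) (X : Multiset ℝ) :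
    (θ : EReal) ≤ rthLargest r X ↔ r ≤ (X.filter (θ ≤ ·)).card := by
  obtain ⟨s, rfl⟩ : ∃ s, r = s + 1 := ⟨r - 1, by omega⟩
  have h := lt_length_filter_iff (θ := θ) (X.sort (· ≥ ·)) (X.pairwise_sort _) s
  have hX : (X.filter (θ ≤ ·)).card = ((X.sort (· ≥ ·)).filter (θ ≤ ·)).length := by
    conv_lhs => rw [← X.sort_eq (· ≥ ·)]
    rw [Multiset.filter_coe, Multiset.coe_card]
  rw [hX, Nat.succ_le_iff, h, rthLargest]
  cases (X.sort (· ≥ ·))[s]? <;> simp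

variable {n : ℕ} {U : Type u} (util : Fin n → U → ℝ)

open scoped Classical in
/-- The agents in `S` whose utility for `a` is at least `θ`. -/
noncomputable def atLeast (S : Finset (Fin n)) (a : U) (θ : ℝ) : Finset (Fin n) :=
  S.filter fun i => θ ≤ util i a

variable {util}

theorem mem_atLeast {S : Finset (Fin n)} {a : U} {θ : ℝ} {i : Fin n} :
    i ∈ atLeast util S a θ ↔ i ∈ S ∧ θ ≤ util i a := by
  simp [atLeast]

theorem inter_atLeast (X S : Finset (Fin n)) (a : U) (θ : ℝ) :
    X ∩ atLeast util S a θ = atLeast util (X ∩ S) a θ := by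
  ext i; simp [mem_atLeast, and_assoc]

theorem atLeast_anti (S : Finset (Fin n)) (a : U) {θ θ' : ℝ} (h : θ ≤ θ') :
    atLeast util S a θ' ⊆ atLeast util S a θ := fun i hi => by
  rw [mem_atLeast] at hi ⊢
  exact ⟨hi.1, h.trans hi.2⟩

/-- An `r`-th largest utility of at least `θ` means that at least `r` agents reach `θ`. A maximizer
thus does as well as any `b` at every threshold simultaneously, without knowing `θ`. -/
theorem IsGenAnswer.le_card {S : Finset (Fin n)} {r : ℕ} {a : U} (ha : IsGenAnswer util S r a)
    (hr : 0 < r) {b : U} {θ : ℝ} (hb : r ≤ (atLeast util S b θ).card) :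
    r ≤ (atLeast util S a θ).card := by
  have key : ∀ c, (θ : EReal) ≤ rthLargest r (S.val.map fun i => util i c) ↔
      r ≤ (atLeast util S c θ).card := fun c => by
    rw [le_rthLargest_iff hr, Multiset.filter_map, Multiset.card_map, atLeast, Finset.card_def,
      Finset.filter_val]
    simp only [Function.comp_def]
  exact (key a).1 (((key b).2 hb).trans (ha b))

/-- The statement `a` is a good choice for the remaining agents `S`: whenever some statement gives
utility at least `θ` to a proportional share of them, `a` does so for at least `rBar n k` of
them. -/
def RoundGood (util : Fin n → U → ℝ) (k : ℕ) (S : Finset (Fin n)) (a : U) : Prop :=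
  ∀ (b : U) (θ : ℝ), (n : ℝ) / k ≤ (atLeast util S b θ).card →
    rBar n k ≤ (atLeast util S a θ).card

/-- An optimal statement for an accurate sample serves enough agents. -/
theorem rBar_le_of_accurate {S X : Finset (Fin n)} {nx k : ℕ} {a b : U} {θ : ℝ}
    (hpos : 0 < rBarX nx k)
    (hb : rBarX nx k ≤ (X ∩ atLeast util S b θ).card)
    (ha : (atLeast util S a θ).card < rBar n k →
      ((X ∩ atLeast util S a θ).card : ℝ) < rBarX nx k)
    (hgen : rBarX nx k ≤ (X ∩ S).card → IsGenAnswer util (X ∩ S) ⌈rBarX nx k⌉₊ a) :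
    rBar n k ≤ (atLeast util S a θ).card := by
  rw [inter_atLeast] at hb ha
  have hXS : rBarX nx k ≤ (X ∩ S).card := hb.trans <| by
    exact_mod_cast Finset.card_le_card (Finset.filter_subset _ _)
  have h := (hgen hXS).le_card (Nat.ceil_pos.2 hpos) (Nat.ceil_le.2 hb)
  by_contra hlt
  exact absurd (Nat.ceil_le.1 h) (not_le.2 (ha (not_le.1 hlt)))

open scoped Classical in
/-- The sets of agents in `S` that a single statement can serve at level `θ`. -/
noncomputable def levelSets (util : Fin n → U → ℝ) (S : Finset (Fin n)) (θ : ℝ) :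
    Finset (Finset (Fin n)) :=
  Finset.univ.filter fun R => ∃ a, R = atLeast util S a θ

theorem atLeast_mem_levelSets (S : Finset (Fin n)) (a : U) (θ : ℝ) :
    atLeast util S a θ ∈ levelSets util S θ := by
  simp only [levelSets, Finset.mem_filter, Finset.mem_univ, true_and]
  exact ⟨a, rfl⟩

theorem le_vcDim_of_shatters {F : Set (U → ℝ)} {m d : ℕ} (h : Shatters F m)
    (hd : vcDim F ≤ (d : ℕ∞)) : m ≤ d := by
  have : (m : ℕ∞) ≤ vcDim F := le_iSup₂ (f := fun (m : ℕ) (_ : Shatters F m) => (m : ℕ∞)) m h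
  exact_mod_cast this.trans hd

/-- A shattered set `T` is a trace of some level set and so lies in `S`. The utility functions of
its members, in any enumeration, are then shattered at the common threshold `θ`. -/
theorem vcDim_levelSets_le {F : Set (U → ℝ)} {d : ℕ} (hF : ∀ i, util i ∈ F)
    (hd : vcDim F ≤ (d : ℕ∞)) (S : Finset (Fin n)) (θ : ℝ) :
    (levelSets util S θ).vcDim ≤ d := by
  classical
  refine Finset.sup_le fun T hT => ?_
  rw [Finset.mem_shatterer] at hT
  have hTS : T ⊆ S := by
    obtain ⟨u, hu, hTu⟩ := hT (Finset.Subset.refl T)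
    obtain ⟨a, rfl⟩ := (Finset.mem_filter.1 hu).2
    exact (Finset.inter_eq_left.1 hTu).trans (Finset.filter_subset _ _)
  refine le_vcDim_of_shatters ⟨fun i => util (T.equivFin.symm i), θ, fun i => hF _, fun I => ?_⟩ hd
  obtain ⟨u, hu, hTu⟩ := hT (t := T.filter fun i => ∃ h : i ∈ T, T.equivFin ⟨i, h⟩ ∈ I)
    (Finset.filter_subset _ _)
  obtain ⟨a, rfl⟩ := (Finset.mem_filter.1 hu).2
  have key : ∀ j, θ ≤ util (T.equivFin.symm j) a ↔ j ∈ I := fun j => by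
    have h1 : ((T.equivFin.symm j : T) : Fin n) ∈ T := (T.equivFin.symm j).2
    have h2 : ((T.equivFin.symm j : T) : Fin n) ∈ T ∩ atLeast util S a θ ↔
        θ ≤ util (T.equivFin.symm j) a := by
      simp [mem_atLeast, hTS h1]
    rw [← h2, hTu]
    simp
  exact ⟨a, fun j hj => (key j).2 hj, fun j hj => not_le.1 fun h => hj ((key j).1 h)⟩

/-- If the VC-dimension vanishes, then no agent distinguishes between statements. -/
theorem le_util_iff_of_vcDim_zero {F : Set (U → ℝ)} (hF : ∀ i, util i ∈ F)
    (hd : vcDim F ≤ ((0 : ℕ) : ℕ∞)) (i : Fin n) (a b : U) (θ : ℝ) (h : θ ≤ util i b) :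
    θ ≤ util i a := by
  by_contra hlt
  refine absurd (le_vcDim_of_shatters (m := 1) ⟨fun _ => util i, θ, fun _ => hF i, fun I => ?_⟩ hd)
    (by norm_num)
  by_cases h0 : (0 : Fin 1) ∈ I
  · refine ⟨b, fun _ _ => h, fun j hj => absurd (Subsingleton.elim j 0 ▸ h0) hj⟩
  · exact ⟨a, fun j hj => absurd (Subsingleton.elim j 0 ▸ hj) h0, fun _ _ => not_le.1 hlt⟩

/-- A finite colouring of a nonempty set of reals has a cofinal colour. -/
theorem exists_cofinal_colour {γ : Type*} [Finite γ] {A : Set ℝ} (hA : A.Nonempty) (f : ℝ → γ) :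
    ∃ c, ∀ θ ∈ A, ∃ θ' ∈ A, θ ≤ θ' ∧ f θ' = c := by
  by_contra! h
  choose g hg hg' using h
  have := Fintype.ofFinite γ
  have : Nonempty γ := ⟨f hA.some⟩
  -- Otherwise each colour `c` is absent from `A` from the point `g c` on. The largest of these
  -- points still has a colour, which is a contradiction.
  obtain ⟨c, -, hc⟩ := Finset.exists_max_image Finset.univ g Finset.univ_nonempty
  exact hg' _ (g c) (hg c) (hc _ (Finset.mem_univ _)) rfl

end Thresholds

/-! ### The sample size -/

section SampleSize

theorem log_div_nonneg {k : ℕ} (hk : 1 ≤ k) {δ : ℝ} (hδ : 0 < δ) (hδ1 : δ ≤ 1) :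
    0 ≤ Real.log (k / δ) := by
  have hk' : (1 : ℝ) ≤ k := by exact_mod_cast hk
  exact Real.log_nonneg (by rw [le_div_iff₀ hδ]; linarith)

theorem sampleSize_le_self (C : ℝ) (n k d : ℕ) (δ : ℝ) : sampleSize C n k d δ ≤ n := by
  unfold sampleSize
  dsimp only
  split_ifs <;> omega

theorem sampleSize_le {C : ℝ} (hC : 0 ≤ C) (n d : ℕ) {k : ℕ} (hk : 1 ≤ k) {δ : ℝ} (hδ : 0 < δ)
    (hδ1 : δ ≤ 1) :
    (sampleSize C n k d δ : ℝ) ≤ 32 * C * ((k : ℝ) ^ 4 * (d + Real.log (k / δ))) := by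
  have hL := log_div_nonneg hk hδ hδ1
  have hM : (0 : ℝ) ≤ 16 * C * (k : ℝ) ^ 4 * (d + Real.log (k / δ)) := by positivity
  have hfl := Nat.floor_le hM
  have h2 : sampleSize C n k d δ ≤ 2 * ⌊16 * C * (k : ℝ) ^ 4 * (d + Real.log (k / δ))⌋₊ := by
    unfold sampleSize
    dsimp only
    split_ifs <;> omega
  have h3 : (sampleSize C n k d δ : ℝ) ≤
      2 * ⌊16 * C * (k : ℝ) ^ 4 * (d + Real.log (k / δ))⌋₊ := by exact_mod_cast h2
  linarith

theorem rBarX_pos {nx k : ℕ} (hk : 1 ≤ k) (hnx : 0 < nx) : 0 < rBarX nx k := by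
  have h1 := eps_pos hk
  have h2 := two_mul_eps_le hk
  have : (0 : ℝ) < nx := by exact_mod_cast hnx
  exact mul_pos this (by linarith)

/-- Here `16 * 3840 = 2 * (20 * 1536)`: the factor two absorbs the rounding, because `k ^ 4 * (d +
L) ≥ 1`. -/
theorem floor_sampleSize_ge {k d : ℕ} (hk : 1 ≤ k) (hd : 1 ≤ d) {L : ℝ} (hL : 0 ≤ L) :
    20 * k * (d + L) * (1536 * k ^ 3) ≤ (⌊16 * 3840 * (k : ℝ) ^ 4 * (d + L)⌋₊ : ℝ) := by
  have hk' : (1 : ℝ) ≤ k := by exact_mod_cast hk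
  have hd' : (1 : ℝ) ≤ d := by exact_mod_cast hd
  have h1 := (Nat.lt_floor_add_one (16 * 3840 * (k : ℝ) ^ 4 * (d + L))).le
  have h2 : 1 ≤ (k : ℝ) ^ 4 * (d + L) := one_le_mul_of_one_le_of_one_le (one_le_pow₀ hk')
    (by linarith)
  nlinarith

/-- By `k ≤ exp k` the prefactors are at most `exp (3 + 2k + d(9 + 3k))`, an exponent of at most
`17kd`. The sample size provides `-20k(d + L)`, and what is left is below `exp (-L) = δ / k`. -/
theorem failure_le {k d m : ℕ} (hk : 1 ≤ k) (hd : 1 ≤ d) {δ : ℝ} (hδ : 0 < δ) (hδ1 : δ ≤ 1)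
    (hm : 20 * k * (d + Real.log (k / δ)) * (1536 * k ^ 3) ≤ (m : ℝ)) :
    8 * k * ((3072 * k ^ 3) ^ d * Real.exp (-(m / (1536 * k ^ 3)))) +
      8 * k ^ 2 * Real.exp (-(m / (768 * k ^ 3))) ≤ δ / k := by
  have hk' : (1 : ℝ) ≤ k := by exact_mod_cast hk
  have hd' : (1 : ℝ) ≤ d := by exact_mod_cast hd
  have hL := log_div_nonneg hk hδ hδ1
  set L := Real.log (k / δ) with hLdef
  have hδk : δ / k = Real.exp (-L) := by
    rw [hLdef, ← Real.log_inv, inv_div, Real.exp_log (by positivity)]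
  have h20 : 20 * k * (d + L) ≤ m / (1536 * k ^ 3) := by
    rwa [le_div_iff₀ (by positivity)]
  have hsmall : Real.exp (-(m / (768 * k ^ 3))) ≤ Real.exp (-(m / (1536 * k ^ 3))) := by
    refine Real.exp_le_exp.2 (neg_le_neg ?_)
    gcongr
    norm_num
  have hke : (k : ℝ) ≤ Real.exp k := by linarith [Real.add_one_le_exp (k : ℝ)]
  have he := Real.exp_one_gt_d9
  have h16 : (16 : ℝ) ≤ Real.exp 3 := by
    calc (16 : ℝ) ≤ 2.7 ^ 3 := by norm_num
      _ ≤ Real.exp 1 ^ 3 := by gcongr; linarith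
      _ = Real.exp 3 := by rw [← Real.exp_nat_mul]; norm_num
  have h3072 : (3072 : ℝ) ≤ Real.exp 9 := by
    calc (3072 : ℝ) ≤ 2.7 ^ 9 := by norm_num
      _ ≤ Real.exp 1 ^ 9 := by gcongr; linarith
      _ = Real.exp 9 := by rw [← Real.exp_nat_mul]; norm_num
  have hP1 : (1 : ℝ) ≤ (3072 * k ^ 3) ^ d :=
    one_le_pow₀ (one_le_mul_of_one_le_of_one_le (by norm_num) (one_le_pow₀ hk'))
  rw [hδk]
  calc _ ≤ 8 * k ^ 2 * ((3072 * k ^ 3) ^ d * Real.exp (-(m / (1536 * k ^ 3)))) +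
        8 * k ^ 2 * ((3072 * k ^ 3) ^ d * Real.exp (-(m / (1536 * k ^ 3)))) := by
        gcongr
        · exact le_self_pow₀ hk' (by norm_num)
        · exact hsmall.trans (le_mul_of_one_le_left (Real.exp_pos _).le hP1)
    _ = 16 * k ^ 2 * (3072 * k ^ 3) ^ d * Real.exp (-(m / (1536 * k ^ 3))) := by ring
    _ ≤ Real.exp 3 * Real.exp k ^ 2 * (Real.exp 9 * Real.exp k ^ 3) ^ d *
        Real.exp (-(20 * k * (d + L))) := by gcongr
    _ = Real.exp (3 + 2 * k + d * (9 + 3 * k) + -(20 * k * (d + L))) := by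
        rw [← Real.exp_nat_mul, ← Real.exp_nat_mul, ← Real.exp_add, ← Real.exp_add,
          ← Real.exp_nat_mul, ← Real.exp_add, ← Real.exp_add]
        norm_num
    _ ≤ Real.exp (-L) := by
        refine Real.exp_le_exp.2 ?_
        have h1 : (1 : ℝ) ≤ k * d := one_le_mul_of_one_le_of_one_le hk' hd'
        have h2 : (k : ℝ) ≤ k * d := le_mul_of_one_le_right (by linarith) hd'
        have h3 : (d : ℝ) ≤ k * d := le_mul_of_one_le_left (by linarith) hk'
        have h4 : L ≤ k * L := le_mul_of_one_le_left hL hk'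
        nlinarith

end SampleSize

/-! ### A round of the process succeeds with high probability -/

section GoodSamples

variable {n : ℕ} {U : Type u}

theorem card_toFinset_ofFn_inter {m : ℕ} {f : Fin m → Fin n} (hf : Function.Injective f)
    (R : Finset (Fin n)) :
    ((List.ofFn f).toFinset ∩ R).card = (Finset.univ.filter fun i => f i ∈ R).card := by
  rw [← Finset.card_image_of_injective _ hf]
  congr 1
  ext y
  simp only [Finset.mem_inter, List.mem_toFinset, List.mem_ofFn, Finset.mem_image,
    Finset.mem_filter, Finset.mem_univ, true_and]
  constructor
  · rintro ⟨⟨i, rfl⟩, h⟩; exact ⟨i, h, rfl⟩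
  · rintro ⟨i, h, rfl⟩; exact ⟨⟨i, rfl⟩, h⟩

/-- A sample is likely to be accurate for a given large set and a family of small sets. -/
theorem psat_accurate (E : Env n U) {k d m : ℕ} (hk : 1 ≤ k) (hd : 1 ≤ d) {δ : ℝ} (hδ : 0 < δ)
    (hδ1 : δ ≤ 1) (hm : 20 * k * (d + Real.log (k / δ)) * (1536 * k ^ 3) ≤ (m : ℝ))
    (hm0 : 0 < m) (hmn : 2 * m < n) (𝓡 : Finset (Finset (Fin n))) (h𝓡 : 𝓡.vcDim ≤ d)
    (R₀ : Finset (Fin n)) (hR₀ : (n : ℝ) / k ≤ R₀.card) :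
    PSat E (sample m (List.finRange n)) (ENNReal.ofReal (δ / k)) fun X =>
      rBarX m k ≤ (X.toFinset ∩ R₀).card ∧
        ∀ R ∈ 𝓡, (R.card : ℝ) < rBar n k → ((X.toFinset ∩ R).card : ℝ) < rBarX m k := by
  classical
  -- Two disjoint samples need `2 * m` agents. Smaller populations are queried in full instead.
  obtain ⟨e⟩ : Nonempty (Fin m × Bool ↪ Fin n) := Function.Embedding.nonempty_of_card_le (by
    simp; omega)
  have hup := card_overrepresented_le e 𝓡 hk h𝓡 hm0 (by simp; omega)
  have hlow := card_underrepresented_le e R₀ hk (by simpa using hR₀) hm0 (by simp; omega)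
  let e₀ : Fin m ↪ Fin n := ⟨fun i => e (i, false), fun i j h => by simpa using e.injective h⟩
  refine psat_sample (by omega) e₀ ?_
  have hcard : ∀ (σ : Equiv.Perm (Fin n)) R,
      ((List.ofFn fun i => σ (e₀ i)).toFinset ∩ R).card = hits e false R σ := fun σ R =>
    card_toFinset_ofFn_inter (fun i j h => e₀.injective (σ.injective h)) R
  refine le_trans ?_ (mul_le_mul_of_nonneg_left (failure_le hk hd hδ hδ1 hm) (Nat.cast_nonneg _))
  rw [mul_add]
  refine le_trans ?_ (add_le_add hup hlow)
  rw [← Nat.cast_add, Nat.cast_le]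
  refine (Finset.card_le_card fun σ hσ => ?_).trans (Finset.card_union_le _ _)
  have hσ' := (Finset.mem_filter.1 hσ).2
  simp only [hcard] at hσ'
  rw [not_and_or] at hσ'
  rcases hσ' with h | h
  · exact Finset.mem_union_right _ (Finset.mem_filter.2 ⟨Finset.mem_univ _, not_le.1 h⟩)
  · push Not at h
    obtain ⟨R, hR, h1, h2⟩ := h
    refine Finset.mem_union_left _ (Finset.mem_filter.2 ⟨Finset.mem_univ _, R, hR, ?_, h2⟩)
    rw [Fintype.card_fin]
    exact h1.le

/-- With high probability, the sample is such that every correct answer is a good choice. -/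
theorem exists_good_samples (E : Env n U) {F : Set (U → ℝ)} {d k : ℕ} (hF : ∀ i, E.util i ∈ F)
    (hvc : vcDim F ≤ (d : ℕ∞)) (hn : 1 ≤ n) (hk : 1 ≤ k) {δ : ℝ} (hδ : 0 < δ) (hδ1 : δ ≤ 1)
    (S : Finset (Fin n)) {nx : ℕ} (hnx : nx = sampleSize 3840 n k d δ) :
    ∃ G : List (Fin n) → Prop,
      PSat E (sample nx (List.finRange n)) (ENNReal.ofReal (δ / k)) G ∧
      ∀ X, G X → X.Nodup → X.length = nx → ∀ a,
        (rBarX nx k ≤ (X.toFinset ∩ S).card →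
          IsGenAnswer E.util (X.toFinset ∩ S) ⌈rBarX nx k⌉₊ a) →
        RoundGood E.util k S a := by
  have hnxn : nx ≤ n := hnx ▸ sampleSize_le_self _ _ _ _ _
  have htrivial : PSat E (sample nx (List.finRange n)) (ENNReal.ofReal (δ / k)) fun _ => True :=
    (PSat.zero_of_sat (t := 0) ((sat_sample nx (List.finRange n) (by simpa) _ le_rfl).mono le_rfl
      fun _ _ => trivial)).mono (zero_le) fun _ => id
  have hε := eps_pos hk
  have hn' : (0 : ℝ) ≤ n := Nat.cast_nonneg n
  have hrn : rBarX n k ≤ n / k := by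
    rw [rBarX, div_eq_mul_one_div (n : ℝ)]; gcongr; linarith
  have hrr : rBar n k ≤ rBarX n k := by
    unfold rBar rBarX; gcongr; linarith
  -- For `d = 0` the sample may be empty, as for `k = δ = 1`; but then every statement is as good as
  -- any other.
  rcases Nat.eq_zero_or_pos d with rfl | hd
  · refine ⟨_, htrivial, fun X _ _ _ a _ b θ hb => hrr.trans <| hrn.trans <| hb.trans ?_⟩
    rw [Nat.cast_le]
    refine Finset.card_le_card fun i hi => ?_
    rw [mem_atLeast] at hi ⊢
    exact ⟨hi.1, le_util_iff_of_vcDim_zero hF hvc i a b θ hi.2⟩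
  have hL := log_div_nonneg hk hδ hδ1
  have hfl := floor_sampleSize_ge hk hd hL
  have hk' : (1 : ℝ) ≤ k := by exact_mod_cast hk
  have hd' : (1 : ℝ) ≤ d := by exact_mod_cast hd
  unfold sampleSize at hnx
  dsimp only at hnx
  split_ifs at hnx with hcase
  -- The sample contains everybody, so the query optimizes over all of `S` and accuracy is
  -- automatic.
  · subst hnx
    refine ⟨_, htrivial, fun X _ hX hXn a ha b θ hb => ?_⟩
    have huniv : X.toFinset = Finset.univ := by
      rw [← Finset.card_eq_iff_eq_univ, List.toFinset_card_of_nodup hX, hXn, Fintype.card_fin]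
    rw [huniv] at ha
    refine rBar_le_of_accurate (X := Finset.univ) (b := b) (rBarX_pos hk hn) ?_ ?_ ha
    · rw [Finset.univ_inter]; exact hrn.trans hb
    · rw [Finset.univ_inter]; exact fun h => h.trans_le hrr
  rw [← hnx] at hfl hcase
  have hnx0 : 0 < nx := by
    have h1 : (0 : ℝ) < 20 * k * (d + Real.log (k / δ)) * (1536 * k ^ 3) := by positivity
    exact_mod_cast h1.trans_le hfl
  have hpos := rBarX_pos hk hnx0
  let A : Set ℝ := {θ | ∃ b, (n : ℝ) / k ≤ (atLeast E.util S b θ).card}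
  rcases A.eq_empty_or_nonempty with hA | hA
  · exact ⟨_, htrivial, fun X _ _ _ a _ b θ hb => by
      have : θ ∈ A := ⟨b, hb⟩
      rw [hA] at this
      exact this.elim⟩
  have hchoice : ∀ θ : ℝ, ∃ R : Finset (Fin n),
      θ ∈ A → (n : ℝ) / k ≤ R.card ∧ ∃ b, R = atLeast E.util S b θ := fun θ => by
    by_cases h : θ ∈ A
    · obtain ⟨b, hb⟩ := h
      exact ⟨_, fun _ => ⟨hb, b, rfl⟩⟩
    · exact ⟨∅, fun h' => absurd h' h⟩
  choose R₀ hR₀ using hchoice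
  -- The colour of a threshold records its family of level sets and one large set witnessing that it
  -- is attainable; there are finitely many colours. The sample need only be accurate for a cofinal
  -- one.
  obtain ⟨c, hc⟩ := exists_cofinal_colour hA fun θ => (levelSets E.util S θ, R₀ θ)
  obtain ⟨θ₀, hθ₀, -, rfl⟩ := hc _ hA.some_mem
  refine ⟨_, psat_accurate E hk hd hδ hδ1 hfl hnx0 (not_le.1 hcase) (levelSets E.util S θ₀)
    (vcDim_levelSets_le hF hvc S θ₀) (R₀ θ₀) (hR₀ θ₀ hθ₀).1, fun X hX _ _ a ha b θ hb => ?_⟩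
  -- Raise `θ` to a threshold of the chosen colour, argue there, and return by monotonicity.
  obtain ⟨θ', hθ', hle, heq⟩ := hc θ ⟨b, hb⟩
  obtain ⟨h1, h2⟩ := Prod.mk.inj heq
  rw [← h1, ← h2] at hX
  obtain ⟨b', hb'⟩ := (hR₀ θ' hθ').2
  refine (rBar_le_of_accurate (b := b') hpos (hb' ▸ hX.1)
    (hX.2 _ (atLeast_mem_levelSets S a θ')) ha).trans ?_
  exact_mod_cast Finset.card_le_card (atLeast_anti S a hle)

end GoodSamples

/-! ### Balanced justified representation from successful rounds -/

section Representation

variable {n : ℕ} {U : Type u} {util : Fin n → U → ℝ}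

theorem rBar_nonneg {k : ℕ} (hk : 1 ≤ k) : 0 ≤ rBar n k :=
  mul_nonneg (Nat.cast_nonneg n) (sub_nonneg.2 (two_mul_eps_le hk))

theorem rBar_le_div {k : ℕ} (hk : 1 ≤ k) : rBar n k ≤ n / k := by
  have := eps_pos hk
  rw [rBar, div_eq_mul_one_div (n : ℝ)]
  gcongr
  linarith

theorem removedInRound_le_ceil (n k j : ℕ) : removedInRound n k j ≤ ⌈rBar n k⌉₊ := by
  unfold removedInRound
  split_ifs
  · exact le_rfl
  · exact Nat.floor_le_ceil _

theorem floor_rBar_le {k : ℕ} (hk : 1 ≤ k) : ⌊rBar n k⌋₊ ≤ n / k := by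
  rw [← Nat.floor_div_eq_div (K := ℝ) n k]
  exact Nat.floor_mono (rBar_le_div hk)

theorem removedInRound_succ {k : ℕ} (hk : 1 ≤ k) (p : ℕ) : removedInRound n k (1 + p) =
    if p < n - k * ⌊rBar n k⌋₊ then ⌈rBar n k⌉₊ else ⌊rBar n k⌋₊ := by
  have h : (⌊rBar n k⌋ : ℤ) = ⌊rBar n k⌋₊ := (Int.natCast_floor_eq_floor (rBar_nonneg hk)).symm
  have h2 : ((1 + p : ℕ) : ℤ) ≤ (n : ℤ) - k * ⌊rBar n k⌋ ↔ p < n - k * ⌊rBar n k⌋₊ := by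
    rw [h]
    have : ((k * ⌊rBar n k⌋₊ : ℕ) : ℤ) = k * (⌊rBar n k⌋₊ : ℤ) := by push_cast; rfl
    rw [← this]
    omega
  unfold removedInRound
  simp only [h2]

/-- The size of the group represented by the member `p` of the slate. -/
def groupSize (n k p : ℕ) : ℕ := n / k + if p < n % k then 1 else 0

/-- If the floor of `rBar` is below `n / k` (integer division), rounding up still fits into every
group. If they are equal, the rounds allowed to round up are exactly the first `n % k`, whose groups
have the extra place. -/
theorem removedInRound_le_groupSize {k : ℕ} (hk : 1 ≤ k) (p : ℕ) :
    removedInRound n k (1 + p) ≤ groupSize n k p := by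
  have h1 := floor_rBar_le (n := n) hk
  have h2 := Nat.ceil_le_floor_add_one (rBar n k)
  have h3 := Nat.div_add_mod n k
  rw [removedInRound_succ hk, groupSize]
  rcases h1.lt_or_eq with h | h
  · split_ifs <;> omega
  · rw [h] at h2 ⊢
    have h4 : n - k * (n / k) = n % k := by omega
    rw [h4]
    split_ifs <;> omega

theorem sum_groupSize {k : ℕ} (hk : 1 ≤ k) : ∑ p : Fin k, groupSize n k p = n := by
  have h1 : (Finset.range k).filter (· < n % k) = Finset.range (n % k) := by
    ext p
    have : n % k < k := Nat.mod_lt n hk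
    simp only [Finset.mem_filter, Finset.mem_range]
    omega
  rw [← Finset.sum_range (groupSize n k)]
  simp only [groupSize, Finset.sum_add_distrib, Finset.sum_const, Finset.card_range,
    Finset.sum_boole, h1, smul_eq_mul, Nat.cast_id]
  exact Nat.div_add_mod n k

theorem groupSize_eq {k : ℕ} (hk : 1 ≤ k) (p : ℕ) :
    groupSize n k p = ⌊(n : ℝ) / k⌋₊ ∨ groupSize n k p = ⌈(n : ℝ) / k⌉₊ := by
  have hk' : (0 : ℝ) < k := by exact_mod_cast hk
  rw [groupSize]
  split_ifs with h
  · right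
    symm
    rw [Nat.ceil_eq_iff (Nat.succ_ne_zero _)]
    have h1 := Nat.div_add_mod n k
    have h2 := Nat.mod_lt n hk
    constructor
    · rw [lt_div_iff₀ hk']
      have : n / k * k < n := by rw [mul_comm]; omega
      exact_mod_cast this
    · rw [div_le_iff₀ hk']
      have : n ≤ (n / k + 1) * k := by rw [add_mul, mul_comm]; omega
      exact_mod_cast this
  · left
    rw [Nat.floor_div_eq_div, add_zero]

/-- Fewer than `n / k` agents remain after the last round. -/
theorem remaining_lt {k : ℕ} (hn : 1 ≤ n) (hk : 1 ≤ k) :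
    ((n - ∑ p ∈ Finset.range k, removedInRound n k (1 + p) : ℕ) : ℝ) < n / k := by
  have hk' : (1 : ℝ) ≤ k := by exact_mod_cast hk
  have hn' : (1 : ℝ) ≤ n := by exact_mod_cast hn
  have hpos : (0 : ℝ) < n / k := by positivity
  simp_rw [removedInRound_succ hk]
  have hkf : k * ⌊rBar n k⌋₊ ≤ n :=
    (Nat.mul_le_mul_left k (floor_rBar_le hk)).trans (Nat.mul_div_le n k)
  have hkc : ((n - k * ⌈rBar n k⌉₊ : ℕ) : ℝ) < n / k := by
    rcases le_total (k * ⌈rBar n k⌉₊) n with h | h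
    · rw [Nat.cast_sub h, Nat.cast_mul]
      have h1 : (k : ℝ) * rBar n k ≤ k * ⌈rBar n k⌉₊ := by gcongr; exact Nat.le_ceil _
      -- The accuracy `eps k` is chosen so that about half a proportional share is left when every
      -- round rounds up.
      have h2 : (k : ℝ) * rBar n k = n - (n / k) / 2 := by
        unfold rBar eps; field_simp; ring
      linarith
    · rw [Nat.sub_eq_zero_of_le h]; simpa using hpos
  set f := ⌊rBar n k⌋₊
  set c := ⌈rBar n k⌉₊
  have hfc : f ≤ c := Nat.floor_le_ceil _
  have hcf : c ≤ f + 1 := Nat.ceil_le_floor_add_one _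
  rcases hfc.eq_or_lt with h | h
  · simpa [h] using hkc
  · have hc : c = f + 1 := by omega
    rcases le_or_gt k (n - k * f) with h1 | h1
    · rw [Finset.sum_congr rfl fun p hp => if_pos ((Finset.mem_range.1 hp).trans_le h1)]
      simpa using hkc
    -- Here the cap on the rounds that round up is binding, and exactly `n` agents are removed.
    · have h2 : (Finset.range k).filter (· < n - k * f) = Finset.range (n - k * f) := by
        ext p
        simp only [Finset.mem_filter, Finset.mem_range]
        omega
      have h3 : ∑ p ∈ Finset.range k, (if p < n - k * f then c else f) = n := by
        have h4 : ∀ p, (if p < n - k * f then c else f) = f + if p < n - k * f then 1 else 0 :=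
          fun p => by split_ifs <;> omega
        simp only [h4, Finset.sum_add_distrib, Finset.sum_const, Finset.card_range,
          Finset.sum_boole, h2, smul_eq_mul, Nat.cast_id]
        omega
      rw [h3]
      simpa using hpos

/-- A partial assignment of agents to groups can be completed. -/
theorem exists_completion {k : ℕ} (g : Fin n → ℕ) (s : Fin k → ℕ) (hs : ∑ p, s p = n)
    (hg : ∀ p : Fin k, (Finset.univ.filter fun i => g i = p).card ≤ s p) :
    ∃ ω : Fin n → Fin k, (∀ i, g i < k → (ω i : ℕ) = g i) ∧
      ∀ p, (Finset.univ.filter fun i => ω i = p).card = s p := by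
  classical
  have hcard : (Finset.univ.filter fun i => g i < k).card =
      ∑ p : Fin k, (Finset.univ.filter fun i => g i = p).card := by
    rw [Finset.card_eq_sum_card_fiberwise (f := g) (t := Finset.range k)
      (fun i hi => by simpa using hi), Finset.sum_range]
    refine Finset.sum_congr rfl fun p _ => ?_
    congr 1
    ext i
    simp only [Finset.mem_filter, Finset.mem_univ, true_and, and_iff_right_iff_imp]
    rintro h
    exact h ▸ p.2
  have hrest : Fintype.card {i // ¬ g i < k} =
      Fintype.card (Σ p : Fin k, Fin (s p - (Finset.univ.filter fun i => g i = p).card)) := by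
    rw [Fintype.card_subtype_compl, Fintype.card_subtype, hcard, Fintype.card_sigma,
      Fintype.card_fin]
    simp only [Fintype.card_fin]
    rw [Finset.sum_tsub_distrib _ fun p _ => hg p, hs]
  let e := Fintype.equivOfCardEq hrest
  let ω : Fin n → Fin k := fun i => if h : g i < k then ⟨g i, h⟩ else (e ⟨i, h⟩).1
  -- Upper bounds suffice: both sides sum to `n`, so none of them can be strict.
  have hle : ∀ p ∈ Finset.univ, (Finset.univ.filter fun i => ω i = p).card ≤ s p := by
    intro p _
    have hsub : (Finset.univ.filter fun i => ω i = p) ⊆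
        (Finset.univ.filter fun i => g i = p) ∪ Finset.univ.image
          fun x : Fin (s p - (Finset.univ.filter fun i => g i = p).card) =>
            ((e.symm ⟨p, x⟩ : {i // ¬ g i < k}) : Fin n) := by
      intro i hi
      have hi : ω i = p := (Finset.mem_filter.1 hi).2
      by_cases h : g i < k
      · refine Finset.mem_union_left _ (Finset.mem_filter.2 ⟨Finset.mem_univ _, ?_⟩)
        rw [← hi]
        simp [ω, h]
      · refine Finset.mem_union_right _ ?_
        have h1 : (e ⟨i, h⟩).1 = p := by rw [← hi]; simp [ω, h]
        subst h1
        exact Finset.mem_image.2 ⟨(e ⟨i, h⟩).2, Finset.mem_univ _, by simp⟩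
    have h1 := (Finset.card_le_card hsub).trans (Finset.card_union_le _ _)
    have h2 := Finset.card_image_le (s := (Finset.univ : Finset
      (Fin (s p - (Finset.univ.filter fun i => g i = p).card))))
      (f := fun x => ((e.symm ⟨p, x⟩ : {i // ¬ g i < k}) : Fin n))
    rw [Finset.card_fin] at h2
    have := hg p
    omega
  have hsum : ∑ p, (Finset.univ.filter fun i => ω i = p).card = ∑ p, s p := by
    rw [hs, ← Finset.card_eq_sum_card_fiberwise (f := ω) (s := Finset.univ) (t := Finset.univ)
      (fun i _ => by simp), Finset.card_fin]
  refine ⟨ω, fun i h => by simp [ω, h], fun p => ?_⟩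
  exact (Finset.sum_eq_sum_iff_of_le hle).1 hsum p (Finset.mem_univ p)

/-- The slate `W` results from successful rounds, starting with round `j` and the agents `S`. -/
def RoundsOK (util : Fin n → U → ℝ) (k : ℕ) : ℕ → Finset (Fin n) → List U → Prop
  | _, _, [] => True
  | j, S, a :: W => RoundGood util k S a ∧ ∃ S' ⊆ S, S'.card = S.card - removedInRound n k j ∧
      (∀ i ∈ S \ S', ∀ i' ∈ S', util i' a ≤ util i a) ∧ RoundsOK util k (j + 1) S' W

/-- Assigning every removed agent to the round of her removal, no coalition of which some member
was removed has a justified complaint. -/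
theorem RoundsOK.exists_assignment {k j : ℕ} {S : Finset (Fin n)} {W : List U}
    (h : RoundsOK util k j S W) : ∃ g : Fin n → ℕ,
      (∀ p < W.length, (S.filter fun i => g i = p).card ≤ removedInRound n k (j + p)) ∧
      (S.filter fun i => W.length ≤ g i).card =
        S.card - ∑ p ∈ Finset.range W.length, removedInRound n k (j + p) ∧
      ∀ T ⊆ S, ∀ (b : U) (θ : ℝ), (n : ℝ) / k ≤ T.card → (∀ i ∈ T, θ ≤ util i b) →
        (∃ i ∈ T, g i < W.length) → ∃ i ∈ T, ∃ hi : g i < W.length,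
          θ ≤ util i (W.get ⟨g i, hi⟩) := by
  induction W generalizing j S with
  | nil => exact ⟨fun _ => 0, by simp, by simp, by simp⟩
  | cons a W ih =>
    obtain ⟨hgood, S', hS', hcard, htop, hW⟩ := h
    obtain ⟨g, h1, h2, h3⟩ := ih hW
    have hremoved : (S \ S').card ≤ removedInRound n k j := by
      rw [Finset.card_sdiff_of_subset hS', hcard]; omega
    -- Agents removed now get index `0`, and later indices shift by one. Survivors of all rounds end
    -- up at or beyond the slate's length.
    refine ⟨fun i => if i ∈ S' then g i + 1 else 0, fun p hp => ?_, ?_, ?_⟩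
    · cases p with
      | zero =>
        refine (Finset.card_le_card fun i hi => ?_).trans hremoved
        obtain ⟨hiS, hi⟩ := Finset.mem_filter.1 hi
        refine Finset.mem_sdiff.2 ⟨hiS, fun hi' => ?_⟩
        simp [hi'] at hi
      | succ p =>
        have := h1 p (by simpa using hp)
        rw [show j + 1 + p = j + (p + 1) by omega] at this
        refine (Finset.card_le_card fun i hi => ?_).trans this
        obtain ⟨-, hi⟩ := Finset.mem_filter.1 hi
        dsimp only at hi
        split_ifs at hi with hi'
        exact Finset.mem_filter.2 ⟨hi', by omega⟩
    · have : (S.filter fun i => (a :: W).length ≤ if i ∈ S' then g i + 1 else 0) =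
          S'.filter fun i => W.length ≤ g i := by
        ext i
        simp only [Finset.mem_filter, List.length_cons]
        constructor
        · rintro ⟨-, hi⟩
          split_ifs at hi with hi'
          · exact ⟨hi', by omega⟩
          · omega
        · rintro ⟨hi, hi'⟩
          rw [if_pos hi]
          exact ⟨hS' hi, by omega⟩
      rw [this, h2, hcard, List.length_cons, Finset.sum_range_succ', Nat.sub_sub, add_comm]
      simp only [add_zero, add_assoc, add_comm 1]
    · intro T hT b θ hTcard hTb hex
      by_cases hTS' : T ⊆ S'
      · obtain ⟨i, hi, hlt⟩ := hex
        dsimp only at hlt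
        rw [if_pos (hTS' hi), List.length_cons] at hlt
        obtain ⟨i, hi, hi', hθ⟩ := h3 T hTS' b θ hTcard hTb ⟨i, hi, by omega⟩
        exact ⟨i, hi, by simp [hTS' hi, hi'], by simpa [hTS' hi] using hθ⟩
      · obtain ⟨i, hi, hi'⟩ := Finset.not_subset.1 hTS'
        refine ⟨i, hi, by simp [hi'], ?_⟩
        suffices θ ≤ util i a by simpa [hi'] using this
        by_contra hlt
        rw [not_le] at hlt
        have hiS : i ∈ S \ S' := Finset.mem_sdiff.2 ⟨hT hi, hi'⟩
        -- If the removed agent `i` falls short of `θ`, so does everyone kept. Then those reaching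
        -- `θ` are among the other removed agents, fewer than `⌈rBar⌉`.
        have hsub : atLeast util S a θ ⊆ (S \ S').erase i := by
          intro i' hi₂
          rw [mem_atLeast] at hi₂
          refine Finset.mem_erase.2 ⟨fun h => ?_, Finset.mem_sdiff.2 ⟨hi₂.1, fun h => ?_⟩⟩
          · exact absurd hi₂.2 (not_le.2 (h ▸ hlt))
          · exact absurd (hi₂.2.trans (htop i hiS i' h)) (not_le.2 hlt)
        have hTsub : T ⊆ atLeast util S b θ := fun i hi => mem_atLeast.2 ⟨hT hi, hTb i hi⟩
        have hlarge : rBar n k ≤ (atLeast util S a θ).card :=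
          hgood b θ (hTcard.trans (by exact_mod_cast Finset.card_le_card hTsub))
        have h4 := Finset.card_le_card hsub
        rw [Finset.card_erase_of_mem hiS] at h4
        have h5 : 0 < (S \ S').card := Finset.card_pos.2 ⟨i, hiS⟩
        have h6 := Nat.ceil_le.2 hlarge
        have h7 := removedInRound_le_ceil n k j
        omega

/-- Successful rounds produce a slate that satisfies balanced justified representation. -/
theorem RoundsOK.isBJR {W : List U} (hn : 1 ≤ n) (hk : 1 ≤ W.length)
    (h : RoundsOK util W.length 1 Finset.univ W) : IsBJR util W := by
  obtain ⟨g, h1, h2, h3⟩ := h.exists_assignment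
  obtain ⟨ω, hω, hsize⟩ := exists_completion g (fun p : Fin W.length => groupSize n W.length p)
    (sum_groupSize hk) fun p => (h1 p p.2).trans (removedInRound_le_groupSize hk p)
  refine ⟨ω, fun p => hsize p ▸ groupSize_eq hk p, ?_⟩
  rintro ⟨S, b, θ, hS, hSb, hlt⟩
  by_cases hex : ∃ i ∈ S, g i < W.length
  · obtain ⟨i, hi, hi', hθ⟩ := h3 S (Finset.subset_univ S) b θ hS hSb hex
    have : ω i = ⟨g i, hi'⟩ := Fin.ext (hω i hi')
    exact absurd hθ (not_le.2 (this ▸ hlt i hi))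
  · push Not at hex
    have h4 : S.card ≤ (Finset.univ.filter fun i => W.length ≤ g i).card :=
      Finset.card_le_card fun i hi => Finset.mem_filter.2 ⟨Finset.mem_univ _, hex i hi⟩
    rw [h2, Finset.card_fin] at h4
    have h5 : (S.card : ℝ) ≤ _ := Nat.cast_le.2 h4
    linarith [remaining_lt hn hk]

end Representation

/-! ### The process -/

section SamplingProcess

variable {n : ℕ} {U : Type u} {E : Env n U}

theorem sat_nextStatement {nx k : ℕ} (hE : E.AnswersGen nx) {Y : List (Fin n)} (hY : Y.Nodup)
    (hYn : Y.length ≤ nx) :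
    Sat E nx (nextStatement nx k Y Y.length) (Y.length + 1) fun a =>
      rBarX nx k ≤ Y.toFinset.card → IsGenAnswer E.util Y.toFinset ⌈rBarX nx k⌉₊ a := by
  have hcard := List.toFinset_card_of_nodup hY
  unfold nextStatement
  split_ifs with h
  · exact (Sat.gen hE (hcard.trans_le hYn) (by rw [hcard]; exact Nat.ceil_le.2 h)
      fun a ha => Sat.ret (c := 0) fun _ => ha).mono (by omega) fun _ => id
  · exact (Sat.pick fun a => Sat.ret (c := 0) fun h' => absurd (hcard ▸ h') h).mono (by omega)
      fun _ => id

/-- Per round, the quadratic cost is `3 * n ^ 2` for sampling, `n ^ 2` for intersecting and `2 * n ^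
2` for insertion sort. -/
theorem sat_rounds {nx k : ℕ} (hnx : nx ≤ n) (hE : E.AnswersGen nx) (m j : ℕ) {S : List (Fin n)}
    (hS : S.length ≤ n) :
    Sat E nx (rounds nx k m j S) (m * (6 * n ^ 2 + 10 * n + 50) + 1) fun W => W.length = m := by
  induction m generalizing j S with
  | zero => exact (Sat.ret (c := 0) (Q := fun W => W.length = 0) rfl).tick.mono (by omega) fun _ => id
  | succ m ih =>
    refine Sat.mono (Sat.bind (sat_sample nx _ (by simpa) n (by simp)) fun X hX =>
      Sat.bind ((sat_intersection X S).mono (c' := n * (n + 2) + 1) ?_ fun _ => id) fun Y hY =>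
      Sat.bind ((sat_size Y).mono (c' := n + 1) ?_ fun _ => id) fun y hy =>
      Sat.bind (c := n + 1) (Q := fun _ => True) ?_ fun a _ => Sat.ticks (Sat.bind
        ((sat_removeTop a _ S).mono (c' := n * (2 * n + 1) + 3 * n + 3) ?_ fun _ => id)
        fun S' hS' => Sat.bind (ih (j + 1) ?_) fun W hW =>
          (Sat.ret (c := 0) (by simp [hW])).tick) 40) ?_ fun _ => id
    · rw [hX.1]; gcongr
    · subst hY
      have := List.length_filter_le (fun i => decide (i ∈ S)) X
      omega
    · subst hy
      have hYX : Y.length ≤ X.length := hY ▸ List.length_filter_le _ X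
      have hXnd : X.Nodup := by
        obtain ⟨l, hl, hl'⟩ := hX.2
        exact hl.nodup_iff.1 ((List.nodup_finRange n).sublist hl')
      exact (sat_nextStatement hE (hY ▸ hXnd.filter _) (by omega)).mono (by omega)
        fun _ _ => trivial
    · gcongr
    · obtain ⟨D, -, h, -⟩ := hS'
      omega
    · have : nx * (3 * n + 2) ≤ n * (3 * n + 2) := by gcongr
      nlinarith

/-- The good-sample event is chosen anew for the set `S` at hand, which depends on earlier rounds.
Since each sample is drawn afresh, the bound `δ / k` holds from every history, and the rounds add up
by the union bound. -/
theorem psat_rounds {F : Set (U → ℝ)} {d k : ℕ} (hF : ∀ i, E.util i ∈ F)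
    (hvc : vcDim F ≤ (d : ℕ∞)) (hn : 1 ≤ n) (hk : 1 ≤ k) {δ : ℝ} (hδ : 0 < δ) (hδ1 : δ ≤ 1)
    {nx : ℕ} (hnx : nx = sampleSize 3840 n k d δ) (hE : E.AnswersGen nx) (m j : ℕ)
    {S : List (Fin n)} (hS : S.Nodup) :
    PSat E (rounds nx k m j S) (m * ENNReal.ofReal (δ / k)) fun W =>
      RoundsOK E.util k j S.toFinset W := by
  induction m generalizing j S with
  | zero =>
    simpa [rounds] using PSat.zero_of_sat (t := 0) (Sat.ret (c := 0) trivial).tick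
  | succ m ih =>
    have hnxn : nx ≤ n := hnx ▸ sampleSize_le_self _ _ _ _ _
    obtain ⟨G, hG, hgood⟩ := exists_good_samples E hF hvc hn hk hδ hδ1 S.toFinset hnx
    have hsample := (sat_sample (E := E) (t := nx) nx (List.finRange n) (by simpa) n
      (by simp)).and_left hG
    refine PSat.mono (hsample.bind fun X ⟨hX, hGX⟩ =>
      (sat_intersection (t := nx) X S).bind_psat fun Y hY =>
      (sat_size (t := nx) Y).bind_psat fun y hy =>
      Sat.bind_psat (t := nx) (c := Y.length + 1) (Q := RoundGood E.util k S.toFinset) ?_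
        fun a ha => PSat.ticks ((sat_removeTop (t := nx) a _ S).bind_psat fun S' hS' =>
          PSat.bind (η' := 0) (ih (j + 1) (S := S') ?_) fun W hW =>
            PSat.tick (PSat.zero_of_sat (t := 0) (Sat.ret (c := 0) ?_))) 40) ?_ fun _ => id
    · subst hy
      have hYX : Y.length ≤ X.length := hY ▸ List.length_filter_le _ X
      have hXnd : X.Nodup := by
        obtain ⟨l, hl, hl'⟩ := hX.2
        exact hl.nodup_iff.1 ((List.nodup_finRange n).sublist hl')
      have hYf : Y.toFinset = X.toFinset ∩ S.toFinset := by
        subst hY; ext i; simp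
      refine (sat_nextStatement hE (hY ▸ hXnd.filter _) (by omega)).mono le_rfl fun a ha => ?_
      exact hgood X hGX hXnd hX.1 a (hYf ▸ ha)
    · obtain ⟨D, hD, -, -⟩ := hS'
      exact (hD.nodup_iff.2 hS).of_append_right
    · obtain ⟨D, hD, hlen, htop⟩ := hS'
      have hnd := (hD.nodup_iff.2 hS).of_append_right
      refine ⟨ha, S'.toFinset, fun i hi => ?_, ?_, fun i hi i' hi' => ?_, hW⟩
      · exact List.mem_toFinset.2 (hD.mem_iff.1 (List.mem_append_right _ (List.mem_toFinset.1 hi)))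
      · rw [List.toFinset_card_of_nodup hnd, List.toFinset_card_of_nodup hS, hlen]
      · obtain ⟨h1, h2⟩ := Finset.mem_sdiff.1 hi
        rw [List.mem_toFinset] at h1 h2 hi'
        exact htop i ((List.mem_append.1 (hD.mem_iff.2 h1)).resolve_right h2) i' hi'
    · rw [add_zero, Nat.cast_succ, add_mul, one_mul, add_comm]

end SamplingProcess

end GenSocialChoice

open GenSocialChoice in
theorem mainTheorem5 :
    ∃ (C K : ℝ) (P : MvPolynomial (Fin 2) ℕ), 0 < C ∧ 0 < K ∧
      ∀ (U : Type u) (F : Set (U → ℝ)) (d : ℕ), vcDim F ≤ (d : ℕ∞) →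
      ∀ (n k : ℕ), 1 ≤ n → 1 ≤ k →
      ∀ δ : ℝ, 0 < δ → δ ≤ 1 →
      ((sampleSize C n k d δ : ℕ) : ℝ) ≤ K * ((k : ℝ) ^ 4 * (d + Real.log (k / δ))) ∧
      ∀ E : Env n U, (∀ i, E.util i ∈ F) → E.AnswersGen (sampleSize C n k d δ) →
        (∀ o ∈ (run E (samplingProc C n U k d δ) []).support,
          o.1.length = k ∧
          runningTime o.2 ≤ MvPolynomial.eval ![n, k] P ∧
          ∀ (S : Finset (Fin n)) (r : ℕ), Event.gen S r ∈ o.2 →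
            S.card ≤ sampleSize C n k d δ ∧ r ≤ S.card) ∧
        ENNReal.ofReal (1 - δ) ≤
          (run E (samplingProc C n U k d δ) []).toOuterMeasure {o | IsBJR E.util o.1} := by
  refine ⟨3840, 32 * 3840, .X 1 * (6 * .X 0 ^ 2 + 10 * .X 0 + 50) + 41, by norm_num, by norm_num,
    fun U F d hvc n k hn hk δ hδ hδ1 => ⟨sampleSize_le (by norm_num) n d hk hδ hδ1,
      fun E hF hE => ?_⟩⟩
  have hsat : Sat E (sampleSize 3840 n k d δ) (samplingProc 3840 n U k d δ)
      (k * (6 * n ^ 2 + 10 * n + 50) + 1 + 40) fun W => W.length = k :=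
    (sat_rounds (sampleSize_le_self _ _ _ _ _) hE k 1 (by simp)).ticks 40
  refine ⟨fun o ho => ?_, ?_⟩
  · obtain ⟨h1, l, h2, h3, h4⟩ := hsat [] o ho
    rw [List.append_nil] at h2
    subst h2
    refine ⟨h1, h3.trans_eq ?_, h4⟩
    simp
  · have hpsat : PSat E (samplingProc 3840 n U k d δ) (k * ENNReal.ofReal (δ / k))
        fun W => RoundsOK E.util k 1 Finset.univ W := by
      have := psat_rounds hF hvc hn hk hδ hδ1 rfl hE k 1 (List.nodup_finRange n)
      rw [List.toFinset_finRange] at this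
      exact this.ticks 40
    have hk' : (0 : ℝ) < k := by exact_mod_cast hk
    have hη : (k : ENNReal) * ENNReal.ofReal (δ / k) = ENNReal.ofReal δ := by
      rw [← ENNReal.ofReal_natCast, ← ENNReal.ofReal_mul hk'.le, mul_div_cancel₀ _ hk'.ne']
    have hbad := ((hsat.and_left hpsat).mono hη.le (Q' := IsBJR E.util) fun W hW => by
      obtain ⟨rfl, hW⟩ := hW
      exact hW.isBJR hn hk) []
    set μ := (run E (samplingProc 3840 n U k d δ) []).toOuterMeasure
    have htotal : (1 : ENNReal) ≤ μ {o | IsBJR E.util o.1} + μ {o | ¬ IsBJR E.util o.1} := by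
      rw [← (PMF.toOuterMeasure_apply_eq_one_iff _ _).2
        (Set.subset_univ (run E (samplingProc 3840 n U k d δ) []).support)]
      refine le_trans (μ.mono fun o _ => ?_) (MeasureTheory.measure_union_le _ _)
      exact em _
    rw [ENNReal.ofReal_sub _ hδ.le, ENNReal.ofReal_one, tsub_le_iff_right]
    exact htotal.trans (by gcongr)
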